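/- **Definitions.** An *orthomodular poset* (OMP) is a bounded poset $L$ with an order-reversing involution $a\mapsto a'$ such that $a\vee a'=1$ and $a\wedge a'=0$, the join $a\vee b$ exists whenever $a\perp b$ (i.e. $a\le b'$), and $a\le b$ implies $b=a\vee(a\vee b')'$. Isomorphisms of OMPs are order isomorphisms preserving $'$. A *block* is a maximal (with respect to inclusion) set of pairwise orthogonal atoms. $L$ is *$(n,m)$-homogeneous* if every atom lies in exactly $n$ blocks and every block has exactly $m$ elements. The *Greechie diagram* of $L$ is the hypergraph whose vertices are the atoms and whose edges are the blocks. A *state* on a finite OMP $L$ is a function $s:L\to[0,\infty)$ with $s(1)=1$ and $s(a\vee b)=s(a)+s(b)$ for $a\perp b$; $S(L)\subset\mathbb R^L$ is the convex set of all states and $S_2(L)$ the set of all two-valued ($\{0,1\}$-valued) states. $S_2(L)$ is *full* if for all $x,y\in L$: $x\le y$ if and only if $s(x)\le s(y)$ for all $s\in S_2(L)$. A *concrete logic* on a set $\Omega$ is a family $\mathcal E$ of subsets of $\Omega$ that contains $\Omega$ and is closed under complements and under unions of two disjoint members. A *signed measure* on $\mathcal E$ is a function $\mu:\mathcal E\to\mathbb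 R$ with $\mu(x\cup y)=\mu(x)+\mu(y)$ for disjoint $x,y\in\mathcal E$; $\mathcal E$ is *regular* if every signed measure on $\mathcal E$ extends to a signed measure on the family of all subsets of $\Omega$. A concrete logic is an OMP under inclusion and set complementation. Let $\mathcal L^p_q=\{X\subseteq\{1,\dots,pq\} : \operatorname{card}X\equiv 0 \pmod q\}$. If $S_2(L)$ is full, the *total representation* of $L$ is the family of all sets $\{s\in S_2(L): s(x)=1\}$, $x\in L$, on $\Omega=S_2(L)$. **Theorem 2.1.** 1. Every finite $(3,3)$-homogeneous OMP with exactly 15 atoms is isomorphic to the concrete logic $\mathcal L^3_2$. 2. There are finite $(3,3)$-homogeneous OMPs $L_{17}$ and $L_{27}$, with exactly 17 and 27 atoms respectively, as follows. (a) $L_{17}$ has the Greechie diagram with the vertices $P_0,\dots,P_6,Q_0,\dots,Q_6,R_0,R_1,R_2$ and the 17 edges $\{P_i,Q_i,P_{i+1}\}$ ($i=0,\dots,6$, indices modulo 7), $\{P_0,P_4,R_0\}$, $\{Q_0,Q_2,Q_5\}$, $\{Q_0,Q_3,R_2\}$, $\{P_1,Q_4,R_1\}$, $\{Q_1,Q_3,Q_6\}$,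 $\{Q_1,Q_5,R_0\}$, $\{P_2,P_5,R_2\}$, $\{Q_2,Q_4,Q_6\}$, $\{P_3,P_6,R_1\}$, $\{R_0,R_1,R_2\}$. It has no two-valued state: $S_2(L_{17})=\emptyset$. Its state space is affinely isomorphic to the segment $[0,\frac23]$; in fact $s\mapsto s(P_0)$ is an affine isomorphism of $S(L_{17})$ onto $[0,\frac23]$. (b) $L_{27}$ has the Greechie diagram whose vertices are the 27 points of the $3\times3\times3$ cube $\{0,1,2\}^3$ and whose edges are the 27 three-point lines parallel to the coordinate axes. The set $S_2(L_{27})$ is full and has exactly 12 elements, and the total representation of $L_{27}$ is a regular concrete logic. -/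

import Mathlib

universe u v

/-- An orthomodular poset: a bounded poset with an order-reversing involution `a ↦ aᶜ` that is a
complementation, in which orthogonal elements (`a ≤ bᶜ`) have a join, and in which
`a ≤ b` implies `b = a ∨ (a ∨ bᶜ)ᶜ`. -/
class OrthomodularPoset (L : Type u) extends PartialOrder L, BoundedOrder L, Compl L where
  compl_compl' : ∀ a : L, aᶜᶜ = a
  compl_le_compl' : ∀ a b : L, a ≤ b → bᶜ ≤ aᶜ
  isLUB_compl' : ∀ a : L, IsLUB {a, aᶜ} ⊤
  isGLB_compl' : ∀ a : L, IsGLB {a, aᶜ} ⊥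
  exists_isLUB' : ∀ a b : L, a ≤ bᶜ → ∃ c, IsLUB {a, b} c
  orthomodular' : ∀ a b c : L, a ≤ b → IsLUB {a, bᶜ} c → IsLUB {a, cᶜ} b

namespace OrthomodularPoset

/-- Isomorphism of orthomodular posets: an order isomorphism that preserves complements. -/
def Isomorphic (L : Type u) (M : Type v) [OrthomodularPoset L] [OrthomodularPoset M] : Prop :=
  ∃ e : L ≃o M, ∀ a : L, e aᶜ = (e a)ᶜ

section

variable {L : Type u} [OrthomodularPoset L]

/-- Orthogonality of two elements. -/
def Orth (a b : L) : Prop := a ≤ bᶜ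

/-- A set of pairwise orthogonal atoms. -/
def IsOrthogonalAtomSet (B : Set L) : Prop :=
  (∀ a ∈ B, IsAtom a) ∧ B.Pairwise Orth

/-- A block: a maximal (with respect to inclusion) orthogonal set of atoms. -/
def IsBlock (B : Set L) : Prop := Maximal IsOrthogonalAtomSet B

end

/-- `(n, m)`-homogeneity: each atom lies in exactly `n` blocks, each block has `m` elements. -/
def IsHomogeneous (n m : ℕ) (L : Type u) [OrthomodularPoset L] : Prop :=
  (∀ a : L, IsAtom a → {B : Set L | IsBlock B ∧ a ∈ B}.encard = n) ∧
    ∀ B : Set L, IsBlock B → B.encard = m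

/-- A hypergraph with vertex type `V` and set of edges `D` is the Greechie diagram of `L`, with the
vertex `v` representing the atom `f v`: the vertices correspond bijectively to the atoms, and the
edges are exactly the sets of vertices that correspond to the blocks. -/
structure IsGreechieDiagram {V : Type v} {L : Type u} [OrthomodularPoset L]
    (D : Set (Set V)) (f : V → L) : Prop where
  injective : Function.Injective f
  range_eq : Set.range f = {a : L | IsAtom a}
  mem_iff : ∀ B : Set V, B ∈ D ↔ IsBlock (f '' B)

/-- A state: a nonnegative normalized function that is additive on orthogonal pairs. -/
structure IsState {L : Type u} [OrthomodularPoset L] (s : L → ℝ) : Prop where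
  nonneg : ∀ a, 0 ≤ s a
  map_top : s ⊤ = 1
  add : ∀ a b c : L, Orth a b → IsLUB {a, b} c → s c = s a + s b

/-- The state space `S(L)`. -/
def stateSpace (L : Type u) [OrthomodularPoset L] : Set (L → ℝ) := {s | IsState s}

/-- The set `S₂(L)` of two-valued states. -/
def twoValuedStates (L : Type u) [OrthomodularPoset L] : Set (L → ℝ) :=
  {s | IsState s ∧ ∀ a, s a = 0 ∨ s a = 1}

/-- A set of states is full if it determines the order of `L`. -/
def IsFull {L : Type u} [OrthomodularPoset L] (T : Set (L → ℝ)) : Prop :=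
  ∀ x y : L, x ≤ y ↔ ∀ s ∈ T, s x ≤ s y

/-- The total representation of `L`: the family, on the base set `S₂(L)`, of all the sets
`{s ∈ S₂(L) | s x = 1}` with `x ∈ L`. -/
def totalRepresentation (L : Type u) [OrthomodularPoset L] : Set (Set (twoValuedStates L)) :=
  Set.range fun x : L => {s : twoValuedStates L | s.1 x = 1}

end OrthomodularPoset

/-- A concrete logic on `Ω`. -/
structure IsConcreteLogic {Ω : Type u} (E : Set (Set Ω)) : Prop where
  univ_mem : Set.univ ∈ E
  compl_mem : ∀ x ∈ E, xᶜ ∈ E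
  union_mem : ∀ x ∈ E, ∀ y ∈ E, x ∩ y = ∅ → x ∪ y ∈ E

/-- `μ`, restricted to `E`, is a signed measure on `E`, that is, it is additive on disjoint pairs.
The values of `μ` off `E` are irrelevant. -/
def IsSignedMeasureOn {Ω : Type u} (E : Set (Set Ω)) (μ : Set Ω → ℝ) : Prop :=
  ∀ x ∈ E, ∀ y ∈ E, x ∩ y = ∅ → x ∪ y ∈ E → μ (x ∪ y) = μ x + μ y

/-- Regularity: every signed measure on `E` extends to a signed measure on all subsets of `Ω`. -/
def IsRegularLogic {Ω : Type u} (E : Set (Set Ω)) : Prop :=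
  ∀ μ : Set Ω → ℝ, IsSignedMeasureOn E μ →
    ∃ ν : Set Ω → ℝ, IsSignedMeasureOn Set.univ ν ∧ ∀ x ∈ E, ν x = μ x

namespace IsConcreteLogic

variable {Ω : Type u} {E : Set (Set Ω)}

theorem empty_mem (h : IsConcreteLogic E) : ∅ ∈ E := by
  simpa using h.compl_mem _ h.univ_mem

theorem isLUB_union (h : IsConcreteLogic E) (a b : E) (hab : a.1 ∩ b.1 = ∅) :
    IsLUB {a, b} (⟨a.1 ∪ b.1, h.union_mem _ a.2 _ b.2 hab⟩ : E) := by
  constructor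
  · rintro x (rfl | rfl)
    · exact Set.subset_union_left
    · exact Set.subset_union_right
  · intro x hx
    exact Set.union_subset (hx (Or.inl rfl)) (hx (Or.inr rfl))

/-- A concrete logic, ordered by inclusion and with set complementation, is an orthomodular
poset. -/
abbrev orthomodularPoset (h : IsConcreteLogic E) : OrthomodularPoset E where
  top := ⟨Set.univ, h.univ_mem⟩
  le_top a := Set.subset_univ a.1
  bot := ⟨∅, h.empty_mem⟩
  bot_le a := Set.empty_subset a.1
  compl a := ⟨a.1ᶜ, h.compl_mem _ a.2⟩
  compl_compl' a := Subtype.ext (compl_compl a.1)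
  compl_le_compl' a b hab := Set.compl_subset_compl.2 hab
  isLUB_compl' a := by
    constructor
    · intro x _
      exact Set.subset_univ x.1
    · intro x hx y _
      by_cases hy : y ∈ a.1
      · exact hx (Or.inl rfl) hy
      · exact hx (Or.inr rfl) hy
  isGLB_compl' a := by
    constructor
    · intro x _
      exact Set.empty_subset x.1
    · intro x hx y hy
      exact (hx (Or.inr rfl) hy) (hx (Or.inl rfl) hy)
  exists_isLUB' a b hab := by
    refine ⟨_, h.isLUB_union a b ?_⟩
    ext y
    exact ⟨fun hy => (hab hy.1) hy.2, fun hy => hy.elim⟩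
  orthomodular' a b c hab hc := by
    have hd : a.1 ∩ b.1ᶜ = ∅ := by
      ext y
      exact ⟨fun hy => hy.2 (hab hy.1), fun hy => hy.elim⟩
    have e : c = ⟨a.1 ∪ b.1ᶜ, h.union_mem _ a.2 _ (h.compl_mem _ b.2) hd⟩ :=
      hc.unique (h.isLUB_union a ⟨b.1ᶜ, h.compl_mem _ b.2⟩ hd)
    subst e
    constructor
    · rintro x (rfl | rfl)
      · exact hab
      · intro y hy
        by_contra hb
        exact hy (Or.inr hb)
    · intro x hx y hy
      by_cases hya : y ∈ a.1
      · exact hx (Or.inl rfl) hya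
      · exact hx (Or.inr rfl) (fun hc => hc.elim hya (fun hb => hb hy))

end IsConcreteLogic

/-- The family of all subsets of a `p * q`-element set with cardinality divisible by `q`. -/
def modFamily (p q : ℕ) : Set (Set (Fin (p * q))) := {X | X.ncard ≡ 0 [MOD q]}

theorem isConcreteLogic_modFamily (p q : ℕ) : IsConcreteLogic (modFamily p q) where
  univ_mem := by
    simp [modFamily, Set.ncard_univ, Nat.modEq_zero_iff_dvd]
  compl_mem x hx := by
    have h := Set.ncard_add_ncard_compl x
    simp only [modFamily, Set.mem_ofPred_eq, Nat.modEq_zero_iff_dvd, Nat.card_eq_fintype_card,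
      Fintype.card_fin] at *
    refine (Nat.dvd_add_right hx).1 ?_
    rw [h]
    exact Dvd.intro_left p rfl
  union_mem x hx y hy hxy := by
    have h := Set.ncard_union_eq (Set.disjoint_iff_inter_eq_empty.2 hxy)
    simp only [modFamily, Set.mem_ofPred_eq, Nat.modEq_zero_iff_dvd] at *
    rw [h]
    exact dvd_add hx hy

/-- The concrete logic `𝓛^p_q`, as a type. -/
def ModLogic (p q : ℕ) : Type := modFamily p q

instance (p q : ℕ) : OrthomodularPoset (ModLogic p q) :=
  (isConcreteLogic_modFamily p q).orthomodularPoset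

/-- An affine isomorphism between two convex sets: a bijection that preserves convex
combinations. -/
structure ConvexIso {E : Type u} {F : Type v} [AddCommGroup E] [Module ℝ E] [AddCommGroup F]
    [Module ℝ F] (C : Set E) (D : Set F) where
  toEquiv : C ≃ D
  map_combo : ∀ (x y z : C) (t : ℝ), 0 ≤ t → t ≤ 1 → (z : E) = (1 - t) • (x : E) + t • (y : E) →
    (toEquiv z : F) = (1 - t) • (toEquiv x : F) + t • (toEquiv y : F)

namespace Diagram17

/-- The 17 vertices: seven `P i`, seven `Q i` and three `R i`. -/
abbrev Vertex : Type := Fin 7 ⊕ Fin 7 ⊕ Fin 3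

abbrev P (i : Fin 7) : Vertex := Sum.inl i

abbrev Q (i : Fin 7) : Vertex := Sum.inr (Sum.inl i)

abbrev R (i : Fin 3) : Vertex := Sum.inr (Sum.inr i)

/-- The seven edges of a loop of order 7 (indices modulo 7) and ten further edges. -/
def edges : Set (Set Vertex) :=
  Set.range (fun i : Fin 7 => {P i, Q i, P (i + 1)}) ∪
    {{P 0, P 4, R 0}, {Q 0, Q 2, Q 5}, {Q 0, Q 3, R 2}, {P 1, Q 4, R 1}, {Q 1, Q 3, Q 6},
      {Q 1, Q 5, R 0}, {P 2, P 5, R 2}, {Q 2, Q 4, Q 6}, {P 3, P 6, R 1}, {R 0, R 1, R 2}}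

end Diagram17

namespace Diagram27

/-- The 27 points of the `3 × 3 × 3` cube. -/
abbrev Vertex : Type := Fin 3 → Fin 3

/-- The 27 lines of the cube that are parallel to a coordinate axis: the line through `p` in the
direction `d` consists of the points that agree with `p` in all the coordinates other than `d`. -/
def edges : Set (Set Vertex) :=
  {B | ∃ (d : Fin 3) (p : Vertex), B = {v | ∀ e, e ≠ d → v e = p e}}

end Diagram27

/-!
All logics in the theorem have blocks of three elements, and such a finite orthomodular poset is
determined by the orthogonality graph of its atoms: its elements are the bounds, the atoms and their
complements. The graphs that occur are those without isolated vertices in which every edge lies in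
exactly one triangle (`UniqueTriangles`). For such a graph `G` the logic `TriangleLogic G` is
orthomodular, its blocks are the triangles of `G`, and its states are the nonnegative weights on the
vertices with sum `1` over each triangle (`isState_ofWeight`, `eq_ofWeight_of_isState`). Conversely,
`exists_orderIso_triangleLogic` recognizes an orthomodular poset as such a logic.

*The logic with 15 atoms.* In a `(3, 3)`-homogeneous logic every atom is orthogonal to six others.
With 15 atoms, `15 = 3 + 3 * 4` shows that an atom outside a block is orthogonal to exactly one
atom of the block, so the atoms and blocks form a generalized quadrangle of order `(2, 2)`. The
points off a fixed line `{a, b, c}` fall into three classes of four, and the adjacencies between the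
classes are forced after a choice of labels. This identifies the quadrangle with the fifteen pairs
of points of a six-element set, disjoint pairs being collinear (`exists_doily_iso`), whose logic
consists of the even subsets (`exists_orderIso_modLogic`).

*The logic with 17 atoms.* The linear system of the 17 edges has a one-parameter family of
solutions, in which every weight is `1 / 3`, `t` or `2 / 3 - t`, where `t` is the weight of `P 0`
(`Diagram17.eq_solution`). As `P 1` always has the weight `1 / 3`, no state is two-valued.

*The logic with 27 atoms.* A two-valued state is a Latin square of order `3`, and there are twelve
of these, the planes `x ± y ± z = c` modulo `3` (`Diagram27.twoValuedStates_eq`). They separate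
elements well enough to be full. A function on the cube all of whose line sums are equal is
recovered from its sums over these planes (`Diagram27.sum_planes`); the inversion formula prescribes
the point masses of the extension of a signed measure, whence regularity.
-/

open OrthomodularPoset

/-! ### The logic of a graph with unique triangles -/

/-- A graph without isolated vertices in which every edge lies in exactly one triangle. -/
class UniqueTriangles {V : Type u} (G : SimpleGraph V) : Prop where
  exists_adj (G) : ∀ a, ∃ b, G.Adj a b
  existsUnique_third (G) : ∀ a b, G.Adj a b → ∃! c, G.Adj a c ∧ G.Adj b c

namespace UniqueTriangles

variable {V : Type u} {G : SimpleGraph V} [UniqueTriangles G]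

theorem exists_third {a b : V} (h : G.Adj a b) : ∃ c, G.Adj a c ∧ G.Adj b c :=
  (existsUnique_third G a b h).exists

theorem third_unique {a b c d : V} (h : G.Adj a b) (hac : G.Adj a c) (hbc : G.Adj b c)
    (had : G.Adj a d) (hbd : G.Adj b d) : c = d :=
  (existsUnique_third G a b h).unique ⟨hac, hbc⟩ ⟨had, hbd⟩

end UniqueTriangles

open UniqueTriangles

/-- The logic of a graph `G`, each triangle being pasted in as the eight-element Boolean algebra
of its three vertices: its elements are the bounds, an atom for each vertex, and the complements
of these atoms. -/
inductive TriangleLogic {V : Type u} (G : SimpleGraph V) : Type u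
  | bot : TriangleLogic G
  | top : TriangleLogic G
  | atom : V → TriangleLogic G
  | coatom : V → TriangleLogic G

namespace TriangleLogic

variable {V : Type u} {G : SimpleGraph V}

/-- The order of the logic of a graph: an atom lies below the complement of another one when the
two vertices are adjacent. -/
protected inductive Le : TriangleLogic G → TriangleLogic G → Prop
  | bot_le (x) : TriangleLogic.Le bot x
  | le_top (x) : TriangleLogic.Le x top
  | refl (x) : TriangleLogic.Le x x
  | atom_le_coatom {v w : V} (h : G.Adj v w) : TriangleLogic.Le (atom v) (coatom w)

/-- The orthocomplement. -/
protected def compl : TriangleLogic G → TriangleLogic G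
  | bot => top
  | top => bot
  | atom v => coatom v
  | coatom v => atom v

instance : PartialOrder (TriangleLogic G) where
  le := TriangleLogic.Le
  le_refl := .refl
  le_trans x y z h₁ h₂ := by
    cases h₁ <;> cases h₂ <;> constructor <;> assumption
  le_antisymm x y h₁ h₂ := by
    cases h₁ <;> cases h₂ <;> rfl

instance : BoundedOrder (TriangleLogic G) where
  top := top
  bot := bot
  le_top := .le_top
  bot_le := .bot_le

instance : Compl (TriangleLogic G) where
  compl := TriangleLogic.compl

@[simp] theorem compl_top : (⊤ : TriangleLogic G)ᶜ = ⊥ := rfl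
@[simp] theorem compl_bot : (⊥ : TriangleLogic G)ᶜ = ⊤ := rfl
@[simp] theorem compl_atom (v : V) : (atom v : TriangleLogic G)ᶜ = coatom v := rfl
@[simp] theorem compl_coatom (v : V) : (coatom v : TriangleLogic G)ᶜ = atom v := rfl
@[simp] theorem top_eq : (top : TriangleLogic G) = ⊤ := rfl
@[simp] theorem bot_eq : (bot : TriangleLogic G) = ⊥ := rfl

theorem le_cases {x y : TriangleLogic G} (h : x ≤ y) :
    x = ⊥ ∨ y = ⊤ ∨ x = y ∨ ∃ v w, G.Adj v w ∧ x = atom v ∧ y = coatom w := by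
  cases h with
  | bot_le => exact .inl rfl
  | le_top => exact .inr (.inl rfl)
  | refl => exact .inr (.inr (.inl rfl))
  | atom_le_coatom h => exact .inr (.inr (.inr ⟨_, _, h, rfl, rfl⟩))

@[simp] theorem atom_ne_bot (v : V) : (atom v : TriangleLogic G) ≠ ⊥ := nofun
@[simp] theorem atom_ne_top (v : V) : (atom v : TriangleLogic G) ≠ ⊤ := nofun

@[simp] theorem atom_le_atom {v w : V} : (atom v : TriangleLogic G) ≤ atom w ↔ v = w := by
  constructor
  · rintro (_ | _); rfl
  · rintro rfl; exact le_rfl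

@[simp] theorem coatom_le_coatom {v w : V} :
    (coatom v : TriangleLogic G) ≤ coatom w ↔ v = w := by
  constructor
  · rintro (_ | _); rfl
  · rintro rfl; exact le_rfl

@[simp] theorem atom_le_coatom {v w : V} :
    (atom v : TriangleLogic G) ≤ coatom w ↔ G.Adj v w := by
  constructor
  · rintro (_ | _); assumption
  · exact .atom_le_coatom

@[simp] theorem not_coatom_le_atom {v w : V} : ¬ (coatom v : TriangleLogic G) ≤ atom w := nofun
@[simp] theorem not_top_le_atom {w : V} : ¬ (⊤ : TriangleLogic G) ≤ atom w := nofun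
@[simp] theorem not_top_le_coatom {w : V} : ¬ (⊤ : TriangleLogic G) ≤ coatom w := nofun
@[simp] theorem not_atom_le_bot {w : V} : ¬ (atom w : TriangleLogic G) ≤ ⊥ := nofun
@[simp] theorem not_coatom_le_bot {w : V} : ¬ (coatom w : TriangleLogic G) ≤ ⊥ := nofun
@[simp] theorem not_top_le_bot : ¬ (⊤ : TriangleLogic G) ≤ ⊥ := nofun

theorem atom_injective : Function.Injective (atom : V → TriangleLogic G) :=
  fun _ _ h => atom.inj h

instance [Finite V] : Finite (TriangleLogic G) := by
  let g : Bool ⊕ V ⊕ V → TriangleLogic G :=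
    Sum.elim (fun b => if b then top else bot) (Sum.elim atom coatom)
  refine Finite.of_surjective g fun x => ?_
  cases x with
  | bot => exact ⟨.inl false, rfl⟩
  | top => exact ⟨.inl true, rfl⟩
  | atom v => exact ⟨.inr (.inl v), rfl⟩
  | coatom v => exact ⟨.inr (.inr v), rfl⟩

theorem isLUB_pair_of_le {P : Type*} [Preorder P] {a b : P} (h : a ≤ b) : IsLUB {a, b} b :=
  ⟨by rintro x (rfl | rfl); exacts [h, le_rfl], fun _ hx => hx (.inr rfl)⟩

theorem isLUB_atom_coatom (v : V) : IsLUB {atom v, coatom v} (⊤ : TriangleLogic G) := by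
  refine ⟨fun x _ => le_top, fun x hx => ?_⟩
  have h₁ := hx (.inl rfl)
  have h₂ := hx (.inr rfl)
  cases x <;> simp_all

/-- The join of two orthogonal atoms is the complement of the third vertex of their triangle. -/
theorem isLUB_atom_atom [UniqueTriangles G] {a b c : V} (hab : G.Adj a b) (hac : G.Adj a c)
    (hbc : G.Adj b c) : IsLUB {atom a, atom b} (coatom c : TriangleLogic G) := by
  constructor
  · rintro x (rfl | rfl) <;> simpa
  · intro x hx
    have h₁ := hx (.inl rfl)
    have h₂ := hx (.inr rfl)
    cases x with
    | bot => exact (not_atom_le_bot h₁).elim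
    | top => exact le_top
    | atom w =>
      rw [atom_le_atom] at h₁ h₂
      exact (hab.ne (h₁.trans h₂.symm)).elim
    | coatom w =>
      rw [atom_le_coatom] at h₁ h₂
      exact coatom_le_coatom.2 (third_unique hab hac hbc h₁ h₂)

theorem compl_le_compl_of_le {a b : TriangleLogic G} (h : a ≤ b) : bᶜ ≤ aᶜ := by
  rcases le_cases h with rfl | rfl | rfl | ⟨v, w, hvw, rfl, rfl⟩
  · exact le_top
  · exact bot_le
  · exact le_rfl
  · exact atom_le_coatom.2 hvw.symm

theorem compl_compl_eq (a : TriangleLogic G) : aᶜᶜ = a := by cases a <;> rfl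

theorem isLUB_self_compl (a : TriangleLogic G) : IsLUB {a, aᶜ} ⊤ := by
  cases a with
  | bot => exact isLUB_pair_of_le bot_le
  | top => rw [Set.pair_comm]; exact isLUB_pair_of_le bot_le
  | atom v => exact isLUB_atom_coatom v
  | coatom v => rw [Set.pair_comm]; exact isLUB_atom_coatom v

instance [UniqueTriangles G] : OrthomodularPoset (TriangleLogic G) where
  compl_compl' := compl_compl_eq
  compl_le_compl' _ _ h := compl_le_compl_of_le h
  isLUB_compl' := isLUB_self_compl
  isGLB_compl' a := by
    refine ⟨fun x _ => bot_le, fun x hx => ?_⟩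
    have h₁ := compl_le_compl_of_le (hx (.inl rfl))
    have h₂ := compl_le_compl_of_le (hx (.inr rfl))
    have h₃ := (isLUB_self_compl aᶜ).2 (by rintro y (rfl | rfl); exacts [h₁, h₂])
    simpa [compl_compl_eq] using compl_le_compl_of_le h₃
  exists_isLUB' a b h := by
    rcases le_cases h with rfl | h | h | ⟨v, w, hvw, rfl, hb⟩
    · exact ⟨b, isLUB_pair_of_le bot_le⟩
    · obtain rfl : b = ⊥ := by rw [← compl_compl_eq b, h]; rfl
      exact ⟨a, by rw [Set.pair_comm]; exact isLUB_pair_of_le bot_le⟩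
    · subst h
      exact ⟨⊤, by rw [Set.pair_comm]; exact isLUB_self_compl b⟩
    · obtain rfl : b = atom w := by rw [← compl_compl_eq b, hb]; rfl
      obtain ⟨c, h₁, h₂⟩ := exists_third hvw
      exact ⟨_, isLUB_atom_atom hvw h₁ h₂⟩
  orthomodular' a b c hab hc := by
    rcases le_cases hab with rfl | rfl | rfl | ⟨v, w, h, rfl, rfl⟩
    · rw [hc.unique (isLUB_pair_of_le bot_le), compl_compl_eq]
      exact isLUB_pair_of_le bot_le
    · have : IsLUB {a, ⊤ᶜ} a := by rw [Set.pair_comm]; exact isLUB_pair_of_le bot_le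
      rw [hc.unique this]
      exact isLUB_self_compl a
    · rw [hc.unique (isLUB_self_compl a), Set.pair_comm]
      exact isLUB_pair_of_le bot_le
    · obtain ⟨d, h₁, h₂⟩ := exists_third h
      rw [hc.unique (isLUB_atom_atom h h₁ h₂)]
      exact isLUB_atom_atom h₁ h h₂.symm

theorem orth_atom_atom [UniqueTriangles G] {v w : V} :
    Orth (atom v : TriangleLogic G) (atom w) ↔ G.Adj v w :=
  atom_le_coatom

/-- The orthogonal pairs and their joins. -/
theorem orth_cases [UniqueTriangles G] {a b c : TriangleLogic G} (h : Orth a b)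
    (hc : IsLUB {a, b} c) :
    (a = ⊥ ∧ c = b) ∨ (b = ⊥ ∧ c = a) ∨ (a = bᶜ ∧ c = ⊤) ∨
      ∃ u v w, G.Adj u v ∧ G.Adj u w ∧ G.Adj v w ∧ a = atom u ∧ b = atom v ∧ c = coatom w := by
  rcases le_cases h with rfl | h | h | ⟨v, w, hvw, rfl, hb⟩
  · exact .inl ⟨rfl, hc.unique (isLUB_pair_of_le bot_le)⟩
  · obtain rfl : b = ⊥ := by rw [← compl_compl_eq b, h]; rfl
    rw [Set.pair_comm] at hc
    exact .inr (.inl ⟨rfl, hc.unique (isLUB_pair_of_le bot_le)⟩)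
  · subst h
    rw [Set.pair_comm] at hc
    exact .inr (.inr (.inl ⟨rfl, hc.unique (isLUB_self_compl b)⟩))
  · obtain rfl : b = atom w := by rw [← compl_compl_eq b, hb]; rfl
    obtain ⟨c, h₁, h₂⟩ := exists_third hvw
    exact .inr (.inr (.inr ⟨_, _, c, hvw, h₁, h₂, rfl, rfl, hc.unique (isLUB_atom_atom hvw h₁ h₂)⟩))

theorem isClique_triangle {a b c : V} (hab : G.Adj a b) (hac : G.Adj a c) (hbc : G.Adj b c) :
    G.IsClique {a, b, c} := by
  rintro v (rfl | rfl | rfl) w (rfl | rfl | rfl) h <;>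
    first | exact (h rfl).elim | assumption | exact G.adj_symm ‹_›

section Blocks

variable [UniqueTriangles G] [Nonempty V]

theorem isAtom_iff {x : TriangleLogic G} : IsAtom x ↔ x ∈ Set.range (atom : V → _) := by
  constructor
  · intro h
    cases x with
    | bot => exact (h.1 rfl).elim
    | top =>
      obtain ⟨v⟩ := ‹Nonempty V›
      exact (atom_ne_bot v (h.2 _ ⟨.le_top _, nofun⟩)).elim
    | atom v => exact ⟨v, rfl⟩
    | coatom v =>
      obtain ⟨w, hw⟩ := exists_adj G v
      exact (atom_ne_bot w (h.2 _ ⟨.atom_le_coatom hw.symm, nofun⟩)).elim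
  · rintro ⟨v, rfl⟩
    refine ⟨nofun, fun y hy => ?_⟩
    rcases le_cases hy.le with rfl | h | rfl | ⟨_, _, _, _, h⟩
    · rfl
    · exact (atom_ne_top v h).elim
    · exact (lt_irrefl _ hy).elim
    · exact absurd h nofun

theorem isOrthogonalAtomSet_image {B : Set V} :
    IsOrthogonalAtomSet (atom '' B : Set (TriangleLogic G)) ↔ G.IsClique B := by
  constructor
  · rintro ⟨-, h⟩ v hv w hw hvw
    exact orth_atom_atom.1 (h ⟨v, hv, rfl⟩ ⟨w, hw, rfl⟩ (atom_injective.ne hvw))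
  · intro h
    refine ⟨?_, ?_⟩
    · rintro _ ⟨v, -, rfl⟩
      exact isAtom_iff.2 ⟨v, rfl⟩
    · rintro _ ⟨v, hv, rfl⟩ _ ⟨w, hw, rfl⟩ hvw
      exact orth_atom_atom.2 (h hv hw fun e => hvw (congrArg _ e))

/-- The blocks of the logic of a graph are the triangles of the graph. -/
theorem isBlock_image_iff {B : Set V} : IsBlock (atom '' B : Set (TriangleLogic G)) ↔
    ∃ a b c, G.Adj a b ∧ G.Adj a c ∧ G.Adj b c ∧ B = {a, b, c} := by
  constructor
  · intro h
    have hB := isOrthogonalAtomSet_image.1 h.prop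
    have max : ∀ C : Set V, G.IsClique C → B ⊆ C → C ⊆ B := fun C hC hBC =>
      (Set.image_subset_image_iff atom_injective).1
        (h.le_of_ge (isOrthogonalAtomSet_image.2 hC) (Set.image_mono hBC))
    obtain ⟨a, ha⟩ : B.Nonempty := by
      by_contra hne
      rw [Set.not_nonempty_iff_eq_empty] at hne
      subst hne
      exact max {Classical.arbitrary V} (by simp) (by simp) rfl
    obtain ⟨b, hb, hab⟩ : ∃ b ∈ B, a ≠ b := by
      by_contra! hne
      obtain ⟨b, hb⟩ := exists_adj G a
      have : B ⊆ {a, b} := fun x hx => .inl (hne x hx).symm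
      exact hb.ne (hne b (max {a, b} (by
        rintro v (rfl | rfl) w (rfl | rfl) h <;>
          first | exact (h rfl).elim | assumption | exact G.adj_symm hb) this (.inr rfl)))
    have hab := hB ha hb hab
    obtain ⟨c, hac, hbc⟩ := exists_third hab
    refine ⟨a, b, c, hab, hac, hbc, ?_⟩
    have hsub : B ⊆ {a, b, c} := by
      intro d hd
      by_cases h₁ : d = a
      · exact .inl h₁
      by_cases h₂ : d = b
      · exact .inr (.inl h₂)
      exact .inr (.inr (third_unique hab (hB ha hd (Ne.symm h₁)) (hB hb hd (Ne.symm h₂)) hac hbc))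
    exact hsub.antisymm (max _ (isClique_triangle hab hac hbc) hsub)
  · rintro ⟨a, b, c, hab, hac, hbc, rfl⟩
    refine ⟨isOrthogonalAtomSet_image.2 (isClique_triangle hab hac hbc), fun C hC hle x hx => ?_⟩
    obtain ⟨d, rfl⟩ := isAtom_iff.1 (hC.1 x hx)
    by_cases h₁ : d = a
    · exact ⟨d, .inl h₁, rfl⟩
    by_cases h₂ : d = b
    · exact ⟨d, .inr (.inl h₂), rfl⟩
    have had := orth_atom_atom.1 (hC.2 (hle ⟨a, by simp, rfl⟩) hx (atom_injective.ne (Ne.symm h₁)))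
    have hbd := orth_atom_atom.1 (hC.2 (hle ⟨b, by simp, rfl⟩) hx (atom_injective.ne (Ne.symm h₂)))
    exact ⟨d, .inr (.inr (third_unique hab had hbd hac hbc)), rfl⟩

theorem exists_eq_image_of_isBlock {B : Set (TriangleLogic G)} (h : IsBlock B) :
    ∃ C : Set V, B = atom '' C := by
  obtain ⟨C, hC⟩ := Set.subset_range_iff_exists_image_eq.1 fun x hx => isAtom_iff.1 (h.prop.1 x hx)
  exact ⟨C, hC.symm⟩

theorem isGreechieDiagram {D : Set (Set V)}
    (hD : ∀ B, B ∈ D ↔ ∃ a b c, G.Adj a b ∧ G.Adj a c ∧ G.Adj b c ∧ B = {a, b, c}) :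
    IsGreechieDiagram D (atom : V → TriangleLogic G) where
  injective := atom_injective
  range_eq := Set.ext fun _ => isAtom_iff.symm
  mem_iff B := by rw [hD, isBlock_image_iff]

theorem isHomogeneous {D : Set (Set V)} (hD : IsGreechieDiagram D (atom : V → TriangleLogic G))
    {n : ℕ} (hn : ∀ v, {B | B ∈ D ∧ v ∈ B}.encard = n) : IsHomogeneous n 3 (TriangleLogic G) := by
  constructor
  · intro x hx
    obtain ⟨v, rfl⟩ := isAtom_iff.1 hx
    rw [← hn v, ← (Set.image_injective.2 (atom_injective (G := G))).encard_image]
    congr 1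
    ext B
    constructor
    · rintro ⟨hB, hv⟩
      obtain ⟨C, rfl⟩ := exists_eq_image_of_isBlock hB
      exact ⟨C, ⟨(hD.mem_iff C).2 hB, atom_injective.mem_set_image.1 hv⟩, rfl⟩
    · rintro ⟨C, ⟨hC, hv⟩, rfl⟩
      exact ⟨(hD.mem_iff C).1 hC, v, hv, rfl⟩
  · intro B hB
    obtain ⟨C, rfl⟩ := exists_eq_image_of_isBlock hB
    obtain ⟨a, b, c, hab, hac, hbc, rfl⟩ := isBlock_image_iff.1 hB
    rw [atom_injective.encard_image]
    exact Set.encard_eq_three.2 ⟨a, b, c, hab.ne, hac.ne, hbc.ne, rfl⟩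

theorem encard_atoms : {a : TriangleLogic G | IsAtom a}.encard = ENat.card V := by
  have : {a : TriangleLogic G | IsAtom a} = atom '' Set.univ := by
    ext x
    rw [Set.image_univ]
    exact isAtom_iff
  rw [this, atom_injective.encard_image, Set.encard_univ]

end Blocks

section States

/-- A weight on the vertices: nonnegative, with sum `1` over each triangle. -/
structure IsWeight (G : SimpleGraph V) (w : V → ℝ) : Prop where
  nonneg : ∀ v, 0 ≤ w v
  sum_eq : ∀ a b c, G.Adj a b → G.Adj a c → G.Adj b c → w a + w b + w c = 1

/-- The extension of a weight on the vertices to the logic. -/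
def ofWeight (w : V → ℝ) : TriangleLogic G → ℝ
  | bot => 0
  | top => 1
  | atom v => w v
  | coatom v => 1 - w v

@[simp] theorem ofWeight_bot (w : V → ℝ) : ofWeight w (⊥ : TriangleLogic G) = 0 := rfl
@[simp] theorem ofWeight_top (w : V → ℝ) : ofWeight w (⊤ : TriangleLogic G) = 1 := rfl
@[simp] theorem ofWeight_atom (w : V → ℝ) (v : V) :
    ofWeight w (atom v : TriangleLogic G) = w v := rfl
@[simp] theorem ofWeight_coatom (w : V → ℝ) (v : V) :
    ofWeight w (coatom v : TriangleLogic G) = 1 - w v := rfl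

theorem ofWeight_compl (w : V → ℝ) (x : TriangleLogic G) :
    ofWeight w xᶜ = 1 - ofWeight w x := by
  cases x <;> simp

variable [UniqueTriangles G]

theorem isState_ofWeight {w : V → ℝ} (hw : IsWeight G w) :
    IsState (ofWeight w : TriangleLogic G → ℝ) where
  nonneg x := by
    cases x with
    | bot => exact le_rfl
    | top => exact zero_le_one
    | atom v => exact hw.nonneg v
    | coatom v =>
      obtain ⟨a, ha⟩ := exists_adj G v
      obtain ⟨b, hb, hab⟩ := exists_third ha
      have := hw.sum_eq v a b ha hb hab
      rw [ofWeight_coatom]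
      linarith [hw.nonneg a, hw.nonneg b]
  map_top := rfl
  add a b c hab hc := by
    rcases orth_cases hab hc with ⟨rfl, rfl⟩ | ⟨rfl, rfl⟩ | ⟨rfl, rfl⟩ |
      ⟨u, v, w', huv, huw, hvw, rfl, rfl, rfl⟩
    · simp
    · simp
    · simp [ofWeight_compl]
    · simp only [ofWeight_atom, ofWeight_coatom]
      linarith [hw.sum_eq u v w' huv huw hvw]

theorem isWeight_of_isState {s : TriangleLogic G → ℝ} (hs : IsState s) :
    IsWeight G (fun v => s (atom v)) where
  nonneg v := hs.nonneg _
  sum_eq a b c hab hac hbc := by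
    have h₁ := hs.add _ _ _ (orth_atom_atom.2 hab) (isLUB_atom_atom hab hac hbc)
    have h₂ := hs.add (atom c) (coatom c) ⊤ le_rfl (isLUB_atom_coatom c)
    rw [hs.map_top] at h₂
    linarith

theorem eq_ofWeight_of_isState {s : TriangleLogic G → ℝ} (hs : IsState s) :
    s = ofWeight (fun v => s (atom v)) := by
  funext x
  cases x with
  | bot =>
    have := hs.add ⊥ ⊥ ⊥ bot_le (isLUB_pair_of_le le_rfl)
    simp only [bot_eq, ofWeight_bot]
    linarith
  | top => exact hs.map_top
  | atom v => rfl
  | coatom v =>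
    have := hs.add (atom v) (coatom v) ⊤ le_rfl (isLUB_atom_coatom v)
    rw [hs.map_top] at this
    rw [ofWeight_coatom]
    linarith

end States

end TriangleLogic

open TriangleLogic

/-! ### Graphs of triple systems -/

section TripleSystem

variable {V : Type u} {ι : Type v} [DecidableEq V]

/-- The collinearity graph of a family of lines. -/
def collinearityGraph (lines : ι → Finset V) : SimpleGraph V where
  Adj v w := v ≠ w ∧ ∃ i, v ∈ lines i ∧ w ∈ lines i
  symm := ⟨fun _ _ h => ⟨h.1.symm, h.2.imp fun _ hi => hi.symm⟩⟩
  loopless := ⟨fun _ h => h.1 rfl⟩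

instance [Fintype ι] (lines : ι → Finset V) : DecidableRel (collinearityGraph lines).Adj :=
  fun v w => inferInstanceAs (Decidable (v ≠ w ∧ ∃ i, v ∈ lines i ∧ w ∈ lines i))

/-- A family of three-element lines that cover all points, two of which share at most one point,
and such that every triangle of the collinearity graph lies on a line. These are the hypotheses of
Greechie's loop lemma: there are no loops of order two and three. -/
structure IsTriangleFree (lines : ι → Finset V) : Prop where
  card_eq : ∀ i, (lines i).card = 3
  inter_le : ∀ i j, i ≠ j → (lines i ∩ lines j).card ≤ 1
  cover : ∀ v, ∃ i, v ∈ lines i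
  triangle : ∀ a b, (collinearityGraph lines).Adj a b → ∀ c, (collinearityGraph lines).Adj a c →
    (collinearityGraph lines).Adj b c → ∃ i, a ∈ lines i ∧ b ∈ lines i ∧ c ∈ lines i

namespace IsTriangleFree

variable {lines : ι → Finset V} (h : IsTriangleFree lines)
include h

theorem eq_of_mem {i j : ι} {a b : V} (hab : a ≠ b) (hai : a ∈ lines i) (hbi : b ∈ lines i)
    (haj : a ∈ lines j) (hbj : b ∈ lines j) : i = j := by
  by_contra hij
  exact hab (Finset.card_le_one.1 (h.inter_le i j hij) a (by simp [*]) b (by simp [*]))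

theorem line_eq {i : ι} {a b c : V} (hab : a ≠ b) (hac : a ≠ c) (hbc : b ≠ c) (ha : a ∈ lines i)
    (hb : b ∈ lines i) (hc : c ∈ lines i) : lines i = {a, b, c} := by
  refine (Finset.eq_of_subset_of_card_le ?_ ?_).symm
  · intro x hx
    simp only [Finset.mem_insert, Finset.mem_singleton] at hx
    rcases hx with rfl | rfl | rfl <;> assumption
  · rw [h.card_eq, Finset.card_eq_three.2 ⟨a, b, c, hab, hac, hbc, rfl⟩]

theorem exists_eq_triple {i : ι} {a : V} (ha : a ∈ lines i) :
    ∃ b c, a ≠ b ∧ a ≠ c ∧ b ≠ c ∧ b ∈ lines i ∧ c ∈ lines i := by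
  have : ((lines i).erase a).card = 2 := by rw [Finset.card_erase_of_mem ha, h.card_eq]
  obtain ⟨b, c, hbc, e⟩ := Finset.card_eq_two.1 this
  have hb : b ∈ (lines i).erase a := by simp [e]
  have hc : c ∈ (lines i).erase a := by simp [e]
  rw [Finset.mem_erase] at hb hc
  exact ⟨b, c, hb.1.symm, hc.1.symm, hbc, hb.2, hc.2⟩

theorem uniqueTriangles : UniqueTriangles (collinearityGraph lines) where
  exists_adj a := by
    obtain ⟨i, hi⟩ := h.cover a
    obtain ⟨b, c, hab, -, -, hb, -⟩ := h.exists_eq_triple hi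
    exact ⟨b, hab, i, hi, hb⟩
  existsUnique_third a b hab := by
    obtain ⟨hne, i, ha, hb⟩ := hab
    have key : ∀ c, (collinearityGraph lines).Adj a c ∧ (collinearityGraph lines).Adj b c →
        c ∈ ((lines i).erase a).erase b := by
      intro c hc
      obtain ⟨j, haj, hbj, hcj⟩ := h.triangle a b ⟨hne, i, ha, hb⟩ c hc.1 hc.2
      rw [← h.eq_of_mem hne ha hb haj hbj] at hcj
      simp [hcj, hc.1.ne.symm, hc.2.ne.symm]
    have card : (((lines i).erase a).erase b).card = 1 := by
      rw [Finset.card_erase_of_mem (by simp [hb, hne.symm]), Finset.card_erase_of_mem ha, h.card_eq]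
    obtain ⟨c, hc⟩ := Finset.card_eq_one.1 card
    have hc' : c ∈ ((lines i).erase a).erase b := by simp [hc]
    simp only [Finset.mem_erase] at hc'
    refine ⟨c, ⟨⟨hc'.2.1.symm, i, ha, hc'.2.2⟩, ⟨hc'.1.symm, i, hb, hc'.2.2⟩⟩, fun d hd => ?_⟩
    have := key d hd
    rwa [hc, Finset.mem_singleton] at this

theorem mem_lines_iff {D : Set (Set V)} (hD : D = Set.range fun i => (lines i : Set V))
    (B : Set V) :
    B ∈ D ↔ ∃ a b c, (collinearityGraph lines).Adj a b ∧ (collinearityGraph lines).Adj a c ∧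
      (collinearityGraph lines).Adj b c ∧ B = {a, b, c} := by
  subst hD
  constructor
  · rintro ⟨i, rfl⟩
    obtain ⟨a, ha⟩ : (lines i).Nonempty := by
      rw [← Finset.card_pos, h.card_eq]
      norm_num
    obtain ⟨b, c, hab, hac, hbc, hb, hc⟩ := h.exists_eq_triple ha
    refine ⟨a, b, c, ⟨hab, i, ha, hb⟩, ⟨hac, i, ha, hc⟩, ⟨hbc, i, hb, hc⟩, ?_⟩
    simp [h.line_eq hab hac hbc ha hb hc]
  · rintro ⟨a, b, c, hab, hac, hbc, rfl⟩
    obtain ⟨i, ha, hb, hc⟩ := h.triangle a b hab c hac hbc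
    exact ⟨i, by simp [h.line_eq hab.1 hac.1 hbc.1 ha hb hc]⟩

theorem encard_lines_through [Fintype ι] {D : Set (Set V)}
    (hD : D = Set.range fun i => (lines i : Set V)) (v : V) :
    {B | B ∈ D ∧ v ∈ B}.encard = (Finset.univ.filter fun i => v ∈ lines i).card := by
  have inj : Function.Injective fun i => (lines i : Set V) := by
    intro i j hij
    replace hij : lines i = lines j := Finset.coe_injective hij
    by_contra hne
    have := h.inter_le i j hne
    rw [← hij, Finset.inter_self, h.card_eq] at this
    omega
  have : {B | B ∈ D ∧ v ∈ B} =
      (fun i => (lines i : Set V)) '' (Finset.univ.filter fun i => v ∈ lines i : Finset ι) := by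
    ext B
    subst hD
    constructor
    · rintro ⟨⟨i, rfl⟩, hv⟩
      exact ⟨i, by simpa using hv, rfl⟩
    · rintro ⟨i, hi, rfl⟩
      exact ⟨⟨i, rfl⟩, by simpa using hi⟩
  rw [this, inj.encard_image, Set.encard_coe_eq_coe_finsetCard]

end IsTriangleFree

end TripleSystem

theorem IsTriangleFree.isWeight_iff {V : Type u} {ι : Type v} [DecidableEq V]
    {lines : ι → Finset V} (h : IsTriangleFree lines) (w : V → ℝ) :
    IsWeight (collinearityGraph lines) w ↔ (∀ v, 0 ≤ w v) ∧ ∀ i, ∑ v ∈ lines i, w v = 1 := by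
  have key : ∀ i a b c, a ≠ b → a ≠ c → b ≠ c → a ∈ lines i → b ∈ lines i → c ∈ lines i →
      ∑ v ∈ lines i, w v = w a + w b + w c := by
    intro i a b c hab hac hbc ha hb hc
    rw [h.line_eq hab hac hbc ha hb hc, Finset.sum_insert (by simp [hab, hac]),
      Finset.sum_pair hbc, add_assoc]
  constructor
  · intro hw
    refine ⟨hw.nonneg, fun i => ?_⟩
    obtain ⟨a, ha⟩ : (lines i).Nonempty := by
      rw [← Finset.card_pos, h.card_eq]
      norm_num
    obtain ⟨b, c, hab, hac, hbc, hb, hc⟩ := h.exists_eq_triple ha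
    rw [key i a b c hab hac hbc ha hb hc]
    exact hw.sum_eq a b c ⟨hab, i, ha, hb⟩ ⟨hac, i, ha, hc⟩ ⟨hbc, i, hb, hc⟩
  · rintro ⟨h₀, h₁⟩
    refine ⟨h₀, fun a b c hab hac hbc => ?_⟩
    obtain ⟨i, ha, hb, hc⟩ := h.triangle a b hab c hac hbc
    rw [← key i a b c hab.ne hac.ne hbc.ne ha hb hc, h₁]

/-! ### The logic with 17 atoms -/

namespace Diagram17

/-- The edges of the diagram, enumerated. -/
def line : Fin 7 ⊕ Fin 10 → Finset Vertex :=
  Sum.elim (fun i => {P i, Q i, P (i + 1)})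
    ![{P 0, P 4, R 0}, {Q 0, Q 2, Q 5}, {Q 0, Q 3, R 2}, {P 1, Q 4, R 1}, {Q 1, Q 3, Q 6},
      {Q 1, Q 5, R 0}, {P 2, P 5, R 2}, {Q 2, Q 4, Q 6}, {P 3, P 6, R 1}, {R 0, R 1, R 2}]

theorem edges_eq : edges = Set.range fun i => (line i : Set Vertex) := by
  have h : (fun i => (line i : Set Vertex)) =
      Sum.elim (fun i => (line (.inl i) : Set Vertex)) (fun i => (line (.inr i) : Set Vertex)) := by
    funext i
    cases i <;> rfl
  rw [h, Set.Sum.elim_range, edges]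
  congr 1
  · simp [line]
  · ext B
    simp [line, Fin.exists_fin_succ, eq_comm (b := B)]

set_option maxRecDepth 100000 in
set_option synthInstance.maxHeartbeats 400000 in
set_option synthInstance.maxSize 4000 in
theorem isTriangleFree : IsTriangleFree line where
  card_eq := by decide +kernel
  inter_le := by decide +kernel
  cover := by decide +kernel
  triangle := by
    decide +kernel

theorem card_lines_through (v : Vertex) : (Finset.univ.filter fun i => v ∈ line i).card = 3 := by
  revert v
  decide +kernel

/-- The collinearity graph of the diagram. -/
abbrev graph : SimpleGraph Vertex := collinearityGraph line

instance : UniqueTriangles graph := isTriangleFree.uniqueTriangles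

/-- The solutions of the linear system of the edges, parametrized by the value at `P 0`. -/
noncomputable def solution (t : ℝ) : Vertex → ℝ :=
  Sum.elim ![t, 1 / 3, 2 / 3 - t, 1 / 3, 1 / 3, 1 / 3, 1 / 3]
    (Sum.elim ![2 / 3 - t, t, t, 1 / 3, 1 / 3, 1 / 3, 2 / 3 - t] ![2 / 3 - t, 1 / 3, t])

theorem sum_lines_iff (w : Vertex → ℝ) : (∀ i, ∑ v ∈ line i, w v = 1) ↔
    (∀ i, w (P i) + w (Q i) + w (P (i + 1)) = 1) ∧
      (w (P 0) + w (P 4) + w (R 0) = 1 ∧ w (Q 0) + w (Q 2) + w (Q 5) = 1 ∧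
      w (Q 0) + w (Q 3) + w (R 2) = 1 ∧ w (P 1) + w (Q 4) + w (R 1) = 1 ∧
      w (Q 1) + w (Q 3) + w (Q 6) = 1 ∧ w (Q 1) + w (Q 5) + w (R 0) = 1 ∧
      w (P 2) + w (P 5) + w (R 2) = 1 ∧ w (Q 2) + w (Q 4) + w (Q 6) = 1 ∧
      w (P 3) + w (P 6) + w (R 1) = 1 ∧ w (R 0) + w (R 1) + w (R 2) = 1) := by
  rw [Sum.forall]
  refine and_congr (forall_congr' fun i => ?_) ?_
  · have h : ∀ i : Fin 7, P i ≠ P (i + 1) := by decide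
    simp [line, h i, add_assoc]
  · simp only [line, Sum.elim_inr, Fin.forall_fin_succ]
    simp [add_assoc]

theorem eq_solution {w : Vertex → ℝ} (hw : IsWeight graph w) : w = solution (w (P 0)) := by
  obtain ⟨h, h₁, h₂, h₃, h₄, h₅, h₆, h₇, h₈, h₉, h₁₀⟩ :=
    (sum_lines_iff w).1 ((isTriangleFree.isWeight_iff w).1 hw).2
  have e₀ : w (P 0) + w (Q 0) + w (P 1) = 1 := h 0
  have e₁ : w (P 1) + w (Q 1) + w (P 2) = 1 := h 1
  have e₂ : w (P 2) + w (Q 2) + w (P 3) = 1 := h 2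
  have e₃ : w (P 3) + w (Q 3) + w (P 4) = 1 := h 3
  have e₄ : w (P 4) + w (Q 4) + w (P 5) = 1 := h 4
  have e₅ : w (P 5) + w (Q 5) + w (P 6) = 1 := h 5
  have e₆ : w (P 6) + w (Q 6) + w (P 0) = 1 := h 6
  funext v
  rcases v with i | i | i <;> fin_cases i <;> simp [solution] <;> linarith

theorem isWeight_solution {t : ℝ} (ht : t ∈ Set.Icc (0 : ℝ) (2 / 3)) :
    IsWeight graph (solution t) := by
  obtain ⟨h₀, h₁⟩ := ht
  rw [isTriangleFree.isWeight_iff, sum_lines_iff]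
  refine ⟨?_, ?_, ?_⟩
  · rintro (i | i | i) <;> fin_cases i <;> simp [solution] <;> linarith
  · intro i
    fin_cases i <;> simp [solution] <;> ring
  · simp only [solution]
    refine ⟨?_, ?_, ?_, ?_, ?_, ?_, ?_, ?_, ?_, ?_⟩ <;> simp <;> ring

theorem mem_Icc {s : TriangleLogic graph → ℝ} (hs : IsState s) :
    s (.atom (P 0)) ∈ Set.Icc (0 : ℝ) (2 / 3) := by
  have h := isWeight_of_isState hs
  have e := congrFun (eq_solution h) (P 2)
  have : s (.atom (P 2)) = 2 / 3 - s (.atom (P 0)) := by simpa [solution] using e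
  exact ⟨h.nonneg _, by linarith [h.nonneg (P 2)]⟩

theorem twoValuedStates_eq_empty : twoValuedStates (TriangleLogic graph) = ∅ := by
  rw [Set.eq_empty_iff_forall_notMem]
  rintro s ⟨hs, h⟩
  have e := congrFun (eq_solution (isWeight_of_isState hs)) (P 1)
  have : s (.atom (P 1)) = 1 / 3 := by simpa [solution] using e
  rcases h (.atom (P 1)) with h | h <;> rw [h] at this <;> norm_num at this

/-- The affine isomorphism of the state space with a segment, given by the value at `P 0`. -/
noncomputable def stateSpaceIso :
    ConvexIso (stateSpace (TriangleLogic graph)) (Set.Icc (0 : ℝ) (2 / 3)) where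
  toEquiv :=
    { toFun := fun s => ⟨s.1 (.atom (P 0)), mem_Icc s.2⟩
      invFun := fun t => ⟨ofWeight (solution t.1), isState_ofWeight (isWeight_solution t.2)⟩
      left_inv := fun s => Subtype.ext <| by
        rw [eq_ofWeight_of_isState s.2, eq_solution (isWeight_of_isState s.2)]
      right_inv := fun t => Subtype.ext rfl }
  map_combo x y z t _ _ h := congrFun h (.atom (P 0))

theorem exists_logic : ∃ (L : Type) (_ : OrthomodularPoset L) (f : Vertex → L),
    Finite L ∧ IsGreechieDiagram edges f ∧ IsHomogeneous 3 3 L ∧ {a : L | IsAtom a}.encard = 17 ∧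
      twoValuedStates L = ∅ ∧
      ∃ e : ConvexIso (stateSpace L) (Set.Icc (0 : ℝ) (2 / 3)),
        ∀ s : stateSpace L, (e.toEquiv s : ℝ) = s.1 (f (P 0)) := by
  have hD : IsGreechieDiagram edges (TriangleLogic.atom : Vertex → TriangleLogic graph) :=
    isGreechieDiagram (isTriangleFree.mem_lines_iff edges_eq)
  refine ⟨TriangleLogic graph, inferInstance, .atom, inferInstance, hD,
    isHomogeneous hD fun v => ?_, ?_, twoValuedStates_eq_empty, stateSpaceIso, fun s => rfl⟩
  · rw [isTriangleFree.encard_lines_through edges_eq, card_lines_through]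
  · rw [encard_atoms]
    simp

end Diagram17

/-! ### Total representations -/

namespace OrthomodularPoset

variable {L : Type u} [OrthomodularPoset L]

theorem apply_compl_of_isState {s : L → ℝ} (hs : IsState s) (a : L) : s aᶜ = 1 - s a := by
  have := hs.add a aᶜ ⊤ (by rw [Orth, compl_compl']) (isLUB_compl' a)
  rw [hs.map_top] at this
  linarith

/-- The set that represents `x` in the total representation. -/
def representing (x : L) : Set (twoValuedStates L) := {s | s.1 x = 1}

theorem mem_representing {x : L} {s : twoValuedStates L} : s ∈ representing x ↔ s.1 x = 1 := Iff.rfl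

theorem representing_mem (x : L) : representing x ∈ totalRepresentation L := ⟨x, rfl⟩

theorem representing_inter {a b : L} (h : Orth a b) : representing a ∩ representing b = ∅ := by
  obtain ⟨c, hc⟩ := exists_isLUB' a b h
  rw [Set.eq_empty_iff_forall_notMem]
  rintro s ⟨ha, hb⟩
  have := s.2.1.add a b c h hc
  rw [mem_representing.1 ha, mem_representing.1 hb] at this
  rcases s.2.2 c with h | h <;> rw [h] at this <;> norm_num at this

theorem representing_union {a b c : L} (h : Orth a b) (hc : IsLUB {a, b} c) :
    representing a ∪ representing b = representing c := by
  ext s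
  have h₁ := s.2.1.add a b c h hc
  simp only [Set.mem_union, mem_representing]
  rcases s.2.2 a with ha | ha <;> rcases s.2.2 b with hb | hb <;> rcases s.2.2 c with hc | hc <;>
    rw [ha, hb, hc] at h₁ <;> first | (exfalso; norm_num at h₁; done) | norm_num [ha, hb, hc]

/-- If the two-valued states are full then disjoint sets represent orthogonal elements. -/
theorem isConcreteLogic_totalRepresentation (h : IsFull (twoValuedStates L)) :
    IsConcreteLogic (totalRepresentation L) where
  univ_mem := ⟨⊤, Set.eq_univ_of_forall fun s => s.2.1.map_top⟩
  compl_mem := by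
    rintro _ ⟨x, rfl⟩
    refine ⟨xᶜ, ?_⟩
    ext s
    simp only [Set.mem_ofPred_eq, Set.mem_compl_iff, apply_compl_of_isState s.2.1]
    rcases s.2.2 x with h | h <;> norm_num [h]
  union_mem := by
    rintro _ ⟨x, rfl⟩ _ ⟨y, rfl⟩ hxy
    have hxy' : Orth x y := by
      refine (h x yᶜ).2 fun s hs => ?_
      rw [apply_compl_of_isState hs.1]
      rcases hs.2 x with h | h <;> rcases hs.2 y with h' | h' <;> norm_num [h, h']
      exact (Set.eq_empty_iff_forall_notMem.1 hxy ⟨s, hs⟩ ⟨h, h'⟩).elim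
    obtain ⟨c, hc⟩ := exists_isLUB' x y hxy'
    exact ⟨c, (representing_union hxy' hc).symm⟩

/-- A real function that is additive on orthogonal pairs. -/
def IsOrthAdditive (m : L → ℝ) : Prop :=
  ∀ a b c : L, Orth a b → IsLUB {a, b} c → m c = m a + m b

theorem isOrthAdditive_of_isSignedMeasureOn {μ : Set (twoValuedStates L) → ℝ}
    (hμ : IsSignedMeasureOn (totalRepresentation L) μ) :
    IsOrthAdditive fun x : L => μ (representing x) := by
  intro a b c h hc
  have e := representing_union h hc
  have := hμ _ (representing_mem a) _ (representing_mem b) (representing_inter h)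
    (e ▸ representing_mem c)
  rwa [e] at this

end OrthomodularPoset

namespace TriangleLogic

variable {V : Type u} {G : SimpleGraph V} [UniqueTriangles G]

theorem sum_of_isOrthAdditive {m : TriangleLogic G → ℝ} (hm : IsOrthAdditive m) {a b c : V}
    (hab : G.Adj a b) (hac : G.Adj a c) (hbc : G.Adj b c) :
    m (atom a) + m (atom b) + m (atom c) = m ⊤ := by
  have h₁ := hm _ _ _ (orth_atom_atom.2 hab) (isLUB_atom_atom hab hac hbc)
  have h₂ := hm (atom c) (coatom c) ⊤ le_rfl (isLUB_atom_coatom c)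
  linarith

theorem eq_of_isOrthAdditive [Nonempty V] {m n : TriangleLogic G → ℝ} (hm : IsOrthAdditive m)
    (hn : IsOrthAdditive n) (h : ∀ v, m (atom v) = n (atom v)) : m = n := by
  have hco : ∀ v, m (coatom v) = n (coatom v) := by
    intro v
    obtain ⟨a, ha⟩ := exists_adj G v
    obtain ⟨b, hb, hab⟩ := exists_third ha
    have hl := isLUB_atom_atom hab ha.symm hb.symm
    rw [hm _ _ _ (orth_atom_atom.2 hab) hl, hn _ _ _ (orth_atom_atom.2 hab) hl, h, h]
  funext x
  cases x with
  | bot =>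
    have h₁ := hm ⊥ ⊥ ⊥ bot_le (isLUB_pair_of_le le_rfl)
    have h₂ := hn ⊥ ⊥ ⊥ bot_le (isLUB_pair_of_le le_rfl)
    rw [bot_eq]
    linarith
  | top =>
    obtain ⟨v⟩ := ‹Nonempty V›
    have hl := isLUB_atom_coatom (G := G) v
    rw [top_eq, hm (atom v) _ _ le_rfl hl, hn (atom v) _ _ le_rfl hl, h, hco]
  | atom v => exact h v
  | coatom v => exact hco v

theorem monotone_of_isState {s : TriangleLogic G → ℝ} (hs : IsState s) : Monotone s := by
  intro x y hxy
  have h₁ : ∀ a, s a ≤ 1 := fun a => by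
    linarith [apply_compl_of_isState hs a, hs.nonneg aᶜ]
  rcases le_cases hxy with rfl | rfl | rfl | ⟨v, w, h, rfl, rfl⟩
  · have := apply_compl_of_isState hs (⊤ : TriangleLogic G)
    rw [hs.map_top, compl_top] at this
    linarith [hs.nonneg y]
  · rw [hs.map_top]
    exact h₁ x
  · exact le_rfl
  · obtain ⟨c, hvc, hwc⟩ := exists_third h
    have := (isWeight_of_isState hs).sum_eq v w c h hvc hwc
    have h₂ := apply_compl_of_isState hs (atom w)
    rw [compl_atom] at h₂
    linarith [hs.nonneg (atom c)]

/-- A set of states is full if it separates any two vertices, contains a state with value `1` on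
any two vertices that are not adjacent, and a state with value `0` on any two vertices. -/
theorem isFull_of_separating [Nonempty V] {T : Set (TriangleLogic G → ℝ)}
    (hT : ∀ s ∈ T, IsState s)
    (h₁ : ∀ v w, v ≠ w → ∃ s ∈ T, s (atom v) = 1 ∧ s (atom w) = 0)
    (h₂ : ∀ v w, ¬ G.Adj v w → ∃ s ∈ T, s (atom v) = 1 ∧ s (atom w) = 1)
    (h₃ : ∀ v w, ∃ s ∈ T, s (atom v) = 0 ∧ s (atom w) = 0) : IsFull T := by
  intro x y
  refine ⟨fun hxy s hs => monotone_of_isState (hT s hs) hxy, fun H => ?_⟩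
  suffices ¬ x ≤ y → ∃ s ∈ T, s x = 1 ∧ s y = 0 by
    by_contra hxy
    obtain ⟨s, hs, h, h'⟩ := this hxy
    have := H s hs
    rw [h, h'] at this
    norm_num at this
  have hco : ∀ s ∈ T, ∀ v, s (coatom v) = 1 - s (atom v) :=
    fun s hs v => apply_compl_of_isState (hT s hs) (atom v)
  have hbot : ∀ s ∈ T, s ⊥ = 0 := fun s hs => by
    have := apply_compl_of_isState (hT s hs) ⊤
    rwa [compl_top, (hT s hs).map_top, sub_self] at this
  intro hxy
  cases x with
  | bot => exact (hxy bot_le).elim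
  | top =>
    cases y with
    | bot =>
      obtain ⟨v⟩ := ‹Nonempty V›
      obtain ⟨s, hs, -⟩ := h₃ v v
      exact ⟨s, hs, (hT s hs).map_top, hbot s hs⟩
    | top => exact (hxy le_rfl).elim
    | atom w =>
      obtain ⟨s, hs, h, -⟩ := h₃ w w
      exact ⟨s, hs, (hT s hs).map_top, h⟩
    | coatom w =>
      obtain ⟨s, hs, h, -⟩ := h₂ w w (G.irrefl)
      exact ⟨s, hs, (hT s hs).map_top, by rw [hco s hs, h, sub_self]⟩
  | atom v =>
    cases y with
    | bot =>
      obtain ⟨s, hs, h, -⟩ := h₂ v v (G.irrefl)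
      exact ⟨s, hs, h, hbot s hs⟩
    | top => exact (hxy le_top).elim
    | atom w => exact h₁ v w fun h => hxy (h ▸ le_rfl)
    | coatom w =>
      obtain ⟨s, hs, h, h'⟩ := h₂ v w fun h => hxy (atom_le_coatom.2 h)
      exact ⟨s, hs, h, by rw [hco s hs, h', sub_self]⟩
  | coatom v =>
    cases y with
    | bot =>
      obtain ⟨s, hs, h, -⟩ := h₃ v v
      exact ⟨s, hs, by rw [hco s hs, h, sub_zero], hbot s hs⟩
    | top => exact (hxy le_top).elim
    | atom w =>
      obtain ⟨s, hs, h, h'⟩ := h₃ v w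
      exact ⟨s, hs, by rw [hco s hs, h, sub_zero], h'⟩
    | coatom w =>
      obtain ⟨s, hs, h, h'⟩ := h₁ w v fun h => hxy (h ▸ le_rfl)
      exact ⟨s, hs, by rw [hco s hs, h', sub_zero], by rw [hco s hs, h, sub_self]⟩

end TriangleLogic

/-! ### The logic with 27 atoms -/

namespace Diagram27

/-- The lines of the cube: `(d, x, y)` is the line in the direction `d` whose points have the
coordinates `x` and `y` at the places `d + 1` and `d + 2`. -/
def line (i : Fin 3 × Fin 3 × Fin 3) : Finset Vertex :=
  Finset.univ.filter fun v => v (i.1 + 1) = i.2.1 ∧ v (i.1 + 2) = i.2.2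

theorem mem_line {i : Fin 3 × Fin 3 × Fin 3} {v : Vertex} :
    v ∈ line i ↔ v (i.1 + 1) = i.2.1 ∧ v (i.1 + 2) = i.2.2 := by
  simp [line]

theorem ne_iff {d e : Fin 3} : e ≠ d ↔ e = d + 1 ∨ e = d + 2 := by
  revert d e
  decide

theorem mem_line_iff_forall {d : Fin 3} {p v : Vertex} :
    v ∈ line (d, p (d + 1), p (d + 2)) ↔ ∀ e, e ≠ d → v e = p e := by
  simp only [mem_line, ne_iff]
  exact ⟨fun h e he => by rcases he with rfl | rfl; exacts [h.1, h.2],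
    fun h => ⟨h _ (.inl rfl), h _ (.inr rfl)⟩⟩

theorem exists_line_eq (i : Fin 3 × Fin 3 × Fin 3) :
    ∃ p : Vertex, i = (i.1, p (i.1 + 1), p (i.1 + 2)) := by
  refine ⟨fun e => if e = i.1 + 1 then i.2.1 else i.2.2, ?_⟩
  have : ∀ d : Fin 3, d + 2 ≠ d + 1 := by decide
  simp [this]

theorem edges_eq : edges = Set.range fun i => (line i : Set Vertex) := by
  ext B
  constructor
  · rintro ⟨d, p, rfl⟩
    exact ⟨(d, p (d + 1), p (d + 2)), Set.ext fun v => mem_line_iff_forall⟩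
  · rintro ⟨i, rfl⟩
    obtain ⟨p, hp⟩ := exists_line_eq i
    refine ⟨i.1, p, Set.ext fun v => ?_⟩
    rw [hp]
    exact mem_line_iff_forall

theorem line_eq_triple : ∀ x y : Fin 3,
    line (0, x, y) = {![0, x, y], ![1, x, y], ![2, x, y]} ∧
    line (1, x, y) = {![y, 0, x], ![y, 1, x], ![y, 2, x]} ∧
    line (2, x, y) = {![x, y, 0], ![x, y, 1], ![x, y, 2]} := by
  decide +kernel

theorem eq_line_of_mem {i j : Fin 3 × Fin 3 × Fin 3} {v : Vertex} (h : i.1 = j.1)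
    (hi : v ∈ line i) (hj : v ∈ line j) : i = j := by
  rw [mem_line] at hi hj
  rw [← h] at hj
  exact Prod.ext h (Prod.ext (hi.1.symm.trans hj.1) (hi.2.symm.trans hj.2))

theorem apply_eq_of_mem {i : Fin 3 × Fin 3 × Fin 3} {v w : Vertex} (hv : v ∈ line i)
    (hw : w ∈ line i) {e : Fin 3} (he : e ≠ i.1) : v e = w e := by
  rw [mem_line] at hv hw
  rcases ne_iff.1 he with rfl | rfl
  · rw [hv.1, hw.1]
  · rw [hv.2, hw.2]

theorem isTriangleFree : IsTriangleFree line where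
  card_eq := by decide +kernel
  inter_le i j hij := by
    refine Finset.card_le_one.2 fun v hv w hw => ?_
    rw [Finset.mem_inter] at hv hw
    have h : i.1 ≠ j.1 := fun h => hij (eq_line_of_mem h hv.1 hv.2)
    funext e
    by_cases he : e = i.1
    · exact apply_eq_of_mem hv.2 hw.2 (he ▸ h)
    · exact apply_eq_of_mem hv.1 hw.1 he
  cover v := ⟨(0, v 1, v 2), mem_line.2 ⟨rfl, rfl⟩⟩
  triangle := by
    rintro a b ⟨hab, i, hai, hbi⟩ c ⟨hac, j, haj, hcj⟩ ⟨hbc, k, hbk, hck⟩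
    by_cases hij : i.1 = j.1
    · obtain rfl := eq_line_of_mem hij hai haj
      exact ⟨i, hai, hbi, hcj⟩
    by_cases hik : i.1 = k.1
    · obtain rfl := eq_line_of_mem hik hbi hbk
      exact ⟨i, hai, hbi, hck⟩
    -- three points that agree pairwise off different coordinates: `c` has the coordinate `i.1`
    -- in common with both `a` and `b`, so that `a = b`
    refine (hab (funext fun e => ?_)).elim
    by_cases he : e = i.1
    · subst he
      rw [apply_eq_of_mem haj hcj hij, apply_eq_of_mem hbk hck hik]
    · exact apply_eq_of_mem hai hbi he

theorem card_lines_through (v : Vertex) : (Finset.univ.filter fun i => v ∈ line i).card = 3 := by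
  simp only [mem_line]
  revert v
  decide +kernel

/-- The collinearity graph of the cube. -/
abbrev graph : SimpleGraph Vertex := collinearityGraph line

instance : UniqueTriangles graph := isTriangleFree.uniqueTriangles

theorem graph_adj_iff {v w : Vertex} :
    graph.Adj v w ↔ v ≠ w ∧ ∃ d : Fin 3, v (d + 1) = w (d + 1) ∧ v (d + 2) = w (d + 2) := by
  refine and_congr_right fun _ => ⟨?_, ?_⟩
  · rintro ⟨i, hv, hw⟩
    rw [mem_line] at hv hw
    exact ⟨i.1, hv.1.trans hw.1.symm, hv.2.trans hw.2.symm⟩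
  · rintro ⟨d, h₁, h₂⟩
    exact ⟨(d, v (d + 1), v (d + 2)), mem_line.2 ⟨rfl, rfl⟩, mem_line.2 ⟨h₁.symm, h₂.symm⟩⟩

/-- The linear form `v 0 ± v 1 ± v 2` on the cube, its points being read modulo `3`. -/
def form (d : Bool × Bool) (v : Vertex) : Fin 3 :=
  v 0 + (if d.1 then v 1 else -v 1) + (if d.2 then v 2 else -v 2)

theorem form_add (d : Bool × Bool) (v w : Vertex) : form d (v + w) = form d v + form d w := by
  obtain ⟨b, c⟩ := d
  cases b <;> cases c <;> simp [form] <;> abel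

/-- The indicator function of the plane on which the linear form `form i.1` has the value `i.2`. -/
def planeWeight (i : (Bool × Bool) × Fin 3) (v : Vertex) : ℝ :=
  if form i.1 v = i.2 then 1 else 0

theorem card_line_plane : ∀ (i : (Bool × Bool) × Fin 3) (j : Fin 3 × Fin 3 × Fin 3),
    ((line j).filter fun v => form i.1 v = i.2).card = 1 := by
  decide +kernel

theorem isWeight_planeWeight (i : (Bool × Bool) × Fin 3) : IsWeight graph (planeWeight i) := by
  refine (isTriangleFree.isWeight_iff _).2 ⟨fun v => ?_, fun j => ?_⟩
  · unfold planeWeight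
    split <;> norm_num
  · simp only [planeWeight, Finset.sum_boole, card_line_plane, Nat.cast_one]

set_option synthInstance.maxHeartbeats 400000 in
set_option synthInstance.maxSize 4000 in
/-- The Latin squares of order `3` are the graphs of the affine functions `c ± x ± y`. -/
theorem exists_form_of_latin : ∀ a₀ a₁ : Fin 3, a₀ ≠ a₁ → ∀ a₂, a₀ ≠ a₂ → a₁ ≠ a₂ →
    ∀ b₀, a₀ ≠ b₀ → ∀ b₁, b₀ ≠ b₁ → a₁ ≠ b₁ → ∀ b₂, b₀ ≠ b₂ → b₁ ≠ b₂ → a₂ ≠ b₂ →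
    ∀ c₀, a₀ ≠ c₀ → b₀ ≠ c₀ → ∀ c₁, c₀ ≠ c₁ → a₁ ≠ c₁ → b₁ ≠ c₁ →
    ∀ c₂, c₀ ≠ c₂ → c₁ ≠ c₂ → a₂ ≠ c₂ → b₂ ≠ c₂ →
    ∃ i : (Bool × Bool) × Fin 3, ∀ x y z : Fin 3, form i.1 ![x, y, z] = i.2 ↔
      z = ![![a₀, a₁, a₂], ![b₀, b₁, b₂], ![c₀, c₁, c₂]] x y := by
  decide +kernel

theorem eq_vec (v : Vertex) : v = ![v 0, v 1, v 2] := by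
  funext i
  fin_cases i <;> rfl

theorem exists_eq_planeWeight {w : Vertex → ℝ} (hw : IsWeight graph w)
    (h : ∀ v, w v = 0 ∨ w v = 1) : ∃ i, w = planeWeight i := by
  have sum := ((isTriangleFree.isWeight_iff w).1 hw).2
  have unique : ∀ v v', v ≠ v' → w v = 1 → w v' = 1 → ¬ ∃ j, v ∈ line j ∧ v' ∈ line j := by
    rintro v v' hne hv hv' ⟨j, hj, hj'⟩
    have : ∑ u ∈ {v, v'}, w u ≤ ∑ u ∈ line j, w u :=
      Finset.sum_le_sum_of_subset_of_nonneg (by simp [Finset.insert_subset_iff, hj, hj'])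
        fun u _ _ => hw.nonneg u
    rw [Finset.sum_pair hne, hv, hv', sum] at this
    norm_num at this
  have ex : ∀ x y, ∃ z, w ![x, y, z] = 1 := by
    intro x y
    by_contra! hz
    have : ∑ u ∈ line (2, x, y), w u = 0 := Finset.sum_eq_zero fun u hu => by
      rw [mem_line] at hu
      have h₀ : u 0 = x := hu.1
      have h₁ : u 1 = y := hu.2
      refine (h u).resolve_right fun hu' => hz (u 2) ?_
      rwa [← h₀, ← h₁, ← eq_vec]
    rw [sum] at this
    norm_num at this
  choose f hf using ex
  have row : ∀ x y y', y ≠ y' → f x y ≠ f x y' := by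
    intro x y y' hy hxy
    refine unique _ _ ?_ (hf x y) (hxy ▸ hf x y') ⟨(1, f x y, x), ?_, ?_⟩
    · exact fun e => hy (congrFun e 1)
    · exact mem_line.2 ⟨rfl, rfl⟩
    · exact mem_line.2 ⟨rfl, rfl⟩
  have col : ∀ x x' y, x ≠ x' → f x y ≠ f x' y := by
    intro x x' y hx hxy
    refine unique _ _ ?_ (hf x y) (hxy ▸ hf x' y) ⟨(0, y, f x y), ?_, ?_⟩
    · exact fun e => hx (congrFun e 0)
    · exact mem_line.2 ⟨rfl, rfl⟩
    · exact mem_line.2 ⟨rfl, rfl⟩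
  have h01 : (0 : Fin 3) ≠ 1 := by decide
  have h02 : (0 : Fin 3) ≠ 2 := by decide
  have h12 : (1 : Fin 3) ≠ 2 := by decide
  obtain ⟨i, hi⟩ := exists_form_of_latin (f 0 0) (f 0 1) (row _ _ _ h01) (f 0 2) (row _ _ _ h02)
    (row _ _ _ h12) (f 1 0) (col _ _ _ h01) (f 1 1) (row _ _ _ h01) (col _ _ _ h01) (f 1 2)
    (row _ _ _ h02) (row _ _ _ h12) (col _ _ _ h01) (f 2 0) (col _ _ _ h02) (col _ _ _ h12)
    (f 2 1) (row _ _ _ h01) (col _ _ _ h02) (col _ _ _ h12) (f 2 2) (row _ _ _ h02)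
    (row _ _ _ h12) (col _ _ _ h02) (col _ _ _ h12)
  have hi' : ∀ x y z, form i.1 ![x, y, z] = i.2 ↔ z = f x y := by
    intro x y z
    rw [hi]
    fin_cases x <;> fin_cases y <;> rfl
  refine ⟨i, funext fun v => ?_⟩
  rw [eq_vec v]
  simp only [planeWeight, hi']
  split_ifs with hv
  · rw [hv, hf]
  · refine (h _).resolve_right fun h' => unique _ _ (fun e => hv (congrFun e 2)) h' (hf (v 0) (v 1))
      ⟨(2, v 0, v 1), ?_, ?_⟩
    · exact mem_line.2 ⟨rfl, rfl⟩
    · exact mem_line.2 ⟨rfl, rfl⟩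

/-- The two-valued state of a plane. -/
def planeState (i : (Bool × Bool) × Fin 3) : TriangleLogic graph → ℝ := ofWeight (planeWeight i)

theorem twoValuedStates_eq : twoValuedStates (TriangleLogic graph) = Set.range planeState := by
  ext s
  constructor
  · rintro ⟨hs, h⟩
    obtain ⟨i, hi⟩ := exists_eq_planeWeight (isWeight_of_isState hs) fun v => h _
    exact ⟨i, by rw [eq_ofWeight_of_isState hs, hi, planeState]⟩
  · rintro ⟨i, rfl⟩
    refine ⟨isState_ofWeight (isWeight_planeWeight i), fun x => ?_⟩
    have h : ∀ v, planeWeight i v = 0 ∨ planeWeight i v = 1 := fun v => by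
      unfold planeWeight
      split <;> simp
    cases x with
    | bot => exact .inl rfl
    | top => exact .inr rfl
    | atom v => exact h v
    | coatom v => rcases h v with h | h <;> simp [planeState, h]

theorem planeState_atom (i : (Bool × Bool) × Fin 3) (v : Vertex) :
    planeState i (atom v) = if form i.1 v = i.2 then 1 else 0 := rfl

theorem exists_mem_plane : ∀ i j : (Bool × Bool) × Fin 3, i ≠ j →
    ∃ v, form i.1 v = i.2 ∧ form j.1 v ≠ j.2 := by
  decide +kernel

theorem planeState_injective : Function.Injective planeState := by
  intro i j h
  by_contra hij
  obtain ⟨v, hi, hj⟩ := exists_mem_plane i j hij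
  have := congrFun h (atom v)
  rw [planeState_atom, planeState_atom, if_pos hi, if_neg hj] at this
  norm_num at this

theorem encard_twoValuedStates : (twoValuedStates (TriangleLogic graph)).encard = 12 := by
  rw [twoValuedStates_eq, ← Set.image_univ, planeState_injective.encard_image, Set.encard_univ]
  simp

theorem isFull : IsFull (twoValuedStates (TriangleLogic graph)) := by
  have h₁ : ∀ v w : Vertex, v ≠ w →
      ∃ i : (Bool × Bool) × Fin 3, form i.1 v = i.2 ∧ form i.1 w ≠ i.2 := by
    decide +kernel
  have h₂ : ∀ v w : Vertex,
      ¬ (v ≠ w ∧ ∃ d : Fin 3, v (d + 1) = w (d + 1) ∧ v (d + 2) = w (d + 2)) →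
      ∃ i : (Bool × Bool) × Fin 3, form i.1 v = i.2 ∧ form i.1 w = i.2 := by
    decide +kernel
  have h₃ : ∀ v w : Vertex,
      ∃ i : (Bool × Bool) × Fin 3, form i.1 v ≠ i.2 ∧ form i.1 w ≠ i.2 := by
    decide +kernel
  refine isFull_of_separating (fun s hs => hs.1) (fun v w hvw => ?_) (fun v w hvw => ?_)
    (fun v w => ?_)
  · obtain ⟨i, hv, hw⟩ := h₁ v w hvw
    exact ⟨planeState i, twoValuedStates_eq ▸ ⟨i, rfl⟩, if_pos hv, if_neg hw⟩
  · obtain ⟨i, hv, hw⟩ := h₂ v w (graph_adj_iff.not.1 hvw)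
    exact ⟨planeState i, twoValuedStates_eq ▸ ⟨i, rfl⟩, if_pos hv, if_pos hw⟩
  · obtain ⟨i, hv, hw⟩ := h₃ v w
    exact ⟨planeState i, twoValuedStates_eq ▸ ⟨i, rfl⟩, if_neg hv, if_neg hw⟩

/-- The cube as a product of three copies of `Fin 3`. -/
def vertexEquiv : Fin 3 × Fin 3 × Fin 3 ≃ Vertex where
  toFun p := ![p.1, p.2.1, p.2.2]
  invFun v := (v 0, v 1, v 2)
  left_inv _ := rfl
  right_inv v := (eq_vec v).symm

@[simp] theorem vertexEquiv_apply (x y z : Fin 3) : vertexEquiv (x, y, z) = ![x, y, z] := rfl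

theorem sum_planes_zero {m : Vertex → ℝ} {c : ℝ} (h : ∀ j, ∑ v ∈ line j, m v = c) :
    ∑ d : Bool × Bool, ∑ v, (if form d v = 0 then m v else 0) = 9 * m 0 + 9 * c := by
  have h₀ : ∀ x y, m ![0, x, y] + (m ![1, x, y] + m ![2, x, y]) = c := fun x y => by
    rw [← h (0, x, y), (line_eq_triple x y).1]
    simp
  have h₁ : ∀ x y, m ![x, 0, y] + (m ![x, 1, y] + m ![x, 2, y]) = c := fun x y => by
    rw [← h (1, y, x), (line_eq_triple y x).2.1]
    simp
  have h₂ : ∀ x y, m ![x, y, 0] + (m ![x, y, 1] + m ![x, y, 2]) = c := fun x y => by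
    rw [← h (2, x, y), (line_eq_triple x y).2.2]
    simp
  have e : (0 : Vertex) = ![0, 0, 0] := by decide
  simp only [← vertexEquiv.sum_comp, Fintype.sum_prod_type, Fin.sum_univ_three, Fintype.sum_bool]
  simp [form, e, show -(1 : Fin 3) = 2 from rfl, show -(2 : Fin 3) = 1 from rfl]
  linarith [h₀ 0 0, h₀ 0 1, h₀ 0 2, h₀ 1 0, h₀ 1 1, h₀ 1 2, h₀ 2 0, h₀ 2 1, h₀ 2 2,
    h₁ 0 0, h₁ 0 1, h₁ 0 2, h₁ 1 0, h₁ 2 0, h₂ 0 0, h₂ 0 1, h₂ 0 2, h₂ 1 0, h₂ 2 0]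

/-- Inversion of the Radon transform for the planes of the twelve two-valued states: a function
with constant line sums `c` is recovered from its sums over these planes. -/
theorem sum_planes {m : Vertex → ℝ} {c : ℝ} (h : ∀ j, ∑ v ∈ line j, m v = c) (v : Vertex) :
    ∑ i : (Bool × Bool) × Fin 3, (if form i.1 v = i.2 then
      (∑ u, if form i.1 u = i.2 then m u else 0) / 9 - c / 4 else 0) = m v := by
  have h' : ∀ j, ∑ u ∈ line j, m (v + u) = c := by
    intro j
    rw [← h (j.1, v (j.1 + 1) + j.2.1, v (j.1 + 2) + j.2.2)]
    refine Finset.sum_equiv (Equiv.addLeft v) (fun u => ?_) fun u _ => rfl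
    simp [mem_line]
  have hd : ∀ d : Bool × Bool, (∑ u, if form d u = form d v then m u else 0) =
      ∑ u, if form d u = 0 then m (v + u) else 0 := by
    intro d
    rw [← Equiv.sum_comp (Equiv.addLeft v)]
    simp [form_add]
  have h₀ := sum_planes_zero h'
  rw [add_zero] at h₀
  simp only [Fintype.sum_prod_type, Finset.sum_ite_eq, Finset.mem_univ, if_true] at h₀ ⊢
  simp only [hd, Fintype.sum_bool] at h₀ ⊢
  linarith

/-- Every signed measure extends: the point mass at the state of a plane is the coefficient of that
plane in the inversion formula. -/
theorem isRegularLogic : IsRegularLogic (totalRepresentation (TriangleLogic graph)) := by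
  classical
  intro μ hμ
  have hm := isOrthAdditive_of_isSignedMeasureOn hμ
  let m : Vertex → ℝ := fun v => μ (representing (atom v : TriangleLogic graph))
  let c : ℝ := μ (representing (⊤ : TriangleLogic graph))
  have hline : ∀ j, ∑ v ∈ line j, m v = c := by
    intro j
    obtain ⟨a, b, d, hab, had, hbd, e⟩ :=
      (isTriangleFree.mem_lines_iff edges_eq (line j)).1 (edges_eq ▸ ⟨j, rfl⟩)
    have e' : line j = {a, b, d} := by
      rw [← Finset.coe_inj, e]
      simp
    rw [e', Finset.sum_insert (by simp [hab.ne, had.ne]), Finset.sum_pair hbd.ne, ← add_assoc]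
    exact sum_of_isOrthAdditive hm hab had hbd
  let g : (Bool × Bool) × Fin 3 → twoValuedStates (TriangleLogic graph) :=
    fun i => ⟨planeState i, twoValuedStates_eq ▸ ⟨i, rfl⟩⟩
  let mass : (Bool × Bool) × Fin 3 → ℝ :=
    fun i => (∑ u, if form i.1 u = i.2 then m u else 0) / 9 - c / 4
  let ν : Set (twoValuedStates (TriangleLogic graph)) → ℝ :=
    fun X => ∑ i, if g i ∈ X then mass i else 0
  have hν : ∀ X Y, X ∩ Y = ∅ → ν (X ∪ Y) = ν X + ν Y := by
    intro X Y hXY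
    simp only [ν, ← Finset.sum_add_distrib]
    refine Finset.sum_congr rfl fun i _ => ?_
    have := Set.eq_empty_iff_forall_notMem.1 hXY (g i)
    by_cases hX : g i ∈ X <;> by_cases hY : g i ∈ Y
    · exact (this ⟨hX, hY⟩).elim
    all_goals simp [hX, hY]
  refine ⟨ν, fun X _ Y _ h _ => hν X Y h, ?_⟩
  have key := eq_of_isOrthAdditive
    (isOrthAdditive_of_isSignedMeasureOn (μ := ν) fun X _ Y _ h _ => hν X Y h) hm fun v => by
      have h₁ : ∀ i, g i ∈ representing (atom v) ↔ form i.1 v = i.2 := by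
        intro i
        rw [mem_representing]
        change (if form i.1 v = i.2 then (1 : ℝ) else 0) = 1 ↔ _
        split_ifs with h <;> simp [h]
      simp only [ν, h₁]
      exact sum_planes hline v
  rintro _ ⟨x, rfl⟩
  exact congrFun key x

theorem exists_logic : ∃ (L : Type) (_ : OrthomodularPoset L) (f : Vertex → L),
    Finite L ∧ IsGreechieDiagram edges f ∧ IsHomogeneous 3 3 L ∧ {a : L | IsAtom a}.encard = 27 ∧
      IsFull (twoValuedStates L) ∧ (twoValuedStates L).encard = 12 ∧
      IsConcreteLogic (totalRepresentation L) ∧ IsRegularLogic (totalRepresentation L) := by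
  have hD : IsGreechieDiagram edges (TriangleLogic.atom : Vertex → TriangleLogic graph) :=
    isGreechieDiagram (isTriangleFree.mem_lines_iff edges_eq)
  refine ⟨TriangleLogic graph, inferInstance, .atom, inferInstance, hD,
    isHomogeneous hD fun v => ?_, ?_, isFull, encard_twoValuedStates,
    isConcreteLogic_totalRepresentation isFull, isRegularLogic⟩
  · rw [isTriangleFree.encard_lines_through edges_eq, card_lines_through]
  · rw [encard_atoms]
    simp

end Diagram27

/-! ### Orthomodular posets with three-element blocks -/

namespace OrthomodularPoset

variable {L : Type u} [OrthomodularPoset L]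

theorem Orth.symm {a b : L} (h : Orth a b) : Orth b a := by
  have := compl_le_compl' _ _ h
  rwa [compl_compl'] at this

theorem eq_bot_of_le_of_le_compl {a x : L} (h : a ≤ x) (h' : a ≤ xᶜ) : a = ⊥ :=
  le_bot_iff.1 ((isGLB_compl' x).2 (by rintro y (rfl | rfl) <;> assumption))

theorem bot_compl : (⊥ : L)ᶜ = ⊤ :=
  top_le_iff.1 ((isLUB_compl' (⊥ : L)).2 (by rintro y (rfl | rfl); exacts [bot_le, le_rfl]))

theorem top_compl : (⊤ : L)ᶜ = ⊥ := by rw [← bot_compl, compl_compl']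

theorem not_orth_self {a : L} (ha : IsAtom a) : ¬ Orth a a :=
  fun h => ha.1 (eq_bot_of_le_of_le_compl le_rfl h)

theorem orth_of_le {a b x : L} (ha : a ≤ x) (hb : b ≤ xᶜ) : Orth a b :=
  ha.trans (Orth.symm hb)

/-- An order isomorphism with the logic of a graph, for an orthomodular poset in which all elements
other than the bounds are represented by vertices and their complements. -/
theorem exists_orderIso_triangleLogic {V : Type v} {G : SimpleGraph V} [UniqueTriangles G]
    (g : V → L) (hg : ∀ v w, g v ≤ g w → v = w) (hbot : ∀ v, g v ≠ ⊥)
    (horth : ∀ v w, Orth (g v) (g w) ↔ G.Adj v w)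
    (hall : ∀ x : L, x = ⊥ ∨ x = ⊤ ∨ (∃ v, x = g v) ∨ ∃ v, x = (g v)ᶜ) (hne : (⊥ : L) ≠ ⊤) :
    ∃ e : TriangleLogic G ≃o L, ∀ x, e xᶜ = (e x)ᶜ := by
  let φ : TriangleLogic G → L := fun
    | bot => ⊥
    | top => ⊤
    | atom v => g v
    | coatom v => (g v)ᶜ
  have htop : ∀ v, g v ≠ ⊤ := by
    intro v h
    obtain ⟨w, hw⟩ := exists_adj G v
    exact hw.ne (hg w v (h ▸ le_top)).symm
  have hco : ∀ v w, ¬ (g v)ᶜ ≤ g w := by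
    intro v w h
    obtain ⟨a, ha⟩ := exists_adj G v
    obtain ⟨b, hb, hab⟩ := exists_third ha
    have h₁ := hg a w (((horth a v).2 ha.symm).trans h)
    have h₂ := hg b w (((horth b v).2 hb.symm).trans h)
    exact hab.ne (h₁.trans h₂.symm)
  have hcobot : ∀ v, (g v)ᶜ ≠ ⊥ := fun v h => htop v (by rw [← compl_compl' (g v), h, bot_compl])
  have hcotop : ∀ v, (g v)ᶜ ≠ ⊤ := fun v h => hbot v (by rw [← compl_compl' (g v), h, top_compl])
  have hle : ∀ x y, φ x ≤ φ y ↔ x ≤ y := by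
    intro x y
    cases x with
    | bot => exact iff_of_true bot_le bot_le
    | top =>
      cases y with
      | bot => exact iff_of_false (fun h => hne (top_le_iff.1 h)) not_top_le_bot
      | top => exact iff_of_true le_rfl le_rfl
      | atom w => exact iff_of_false (fun h => htop w (top_le_iff.1 h)) not_top_le_atom
      | coatom w => exact iff_of_false (fun h => hcotop w (top_le_iff.1 h)) not_top_le_coatom
    | atom v =>
      cases y with
      | bot => exact iff_of_false (fun h => hbot v (le_bot_iff.1 h)) not_atom_le_bot
      | top => exact iff_of_true le_top le_top
      | atom w =>
        rw [atom_le_atom]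
        exact ⟨hg v w, fun h => by rw [h]⟩
      | coatom w =>
        rw [atom_le_coatom]
        exact horth v w
    | coatom v =>
      cases y with
      | bot => exact iff_of_false (fun h => hcobot v (le_bot_iff.1 h)) not_coatom_le_bot
      | top => exact iff_of_true le_top le_top
      | atom w => exact iff_of_false (hco v w) not_coatom_le_atom
      | coatom w =>
        rw [coatom_le_coatom]
        refine ⟨fun h => (hg w v ?_).symm, fun h => by rw [h]⟩
        have := compl_le_compl' _ _ h
        rwa [compl_compl', compl_compl'] at this
  have hsurj : Function.Surjective φ := by
    intro x
    rcases hall x with rfl | rfl | ⟨v, rfl⟩ | ⟨v, rfl⟩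
    exacts [⟨bot, rfl⟩, ⟨top, rfl⟩, ⟨atom v, rfl⟩, ⟨coatom v, rfl⟩]
  refine ⟨RelIso.ofSurjective (OrderEmbedding.ofMapLEIff φ hle) hsurj, fun x => ?_⟩
  cases x with
  | bot => exact bot_compl.symm
  | top => exact top_compl.symm
  | atom v => rfl
  | coatom v => exact (compl_compl' (g v)).symm

theorem isomorphic_of_orderIso {K M : Type*} [OrthomodularPoset K]
    [OrthomodularPoset M] (e₁ : K ≃o L) (h₁ : ∀ x, e₁ xᶜ = (e₁ x)ᶜ) (e₂ : K ≃o M)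
    (h₂ : ∀ x, e₂ xᶜ = (e₂ x)ᶜ) : Isomorphic L M := by
  refine ⟨e₁.symm.trans e₂, fun a => ?_⟩
  have : e₁.symm aᶜ = (e₁.symm a)ᶜ := by
    rw [OrderIso.symm_apply_eq, h₁, e₁.apply_symm_apply]
  rw [OrderIso.trans_apply, OrderIso.trans_apply, this, h₂]

theorem exists_atom_le [Finite L] {x : L} (hx : x ≠ ⊥) : ∃ a, IsAtom a ∧ a ≤ x :=
  (IsAtomic.eq_bot_or_exists_atom_le x).resolve_left hx

/-- Below an element that is strictly above `a` there is an atom orthogonal to `a`, because the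
element is the join of `a` and a nonzero element orthogonal to `a`. -/
theorem exists_atom_orth [Finite L] {a x : L} (h : a < x) : ∃ c, IsAtom c ∧ c ≤ x ∧ Orth a c := by
  obtain ⟨d, hd⟩ := exists_isLUB' a xᶜ (by rw [compl_compl']; exact h.le)
  have hx := orthomodular' a x d h.le hd
  obtain ⟨c, hc, hcd⟩ := exists_atom_le (x := dᶜ) fun hbot => h.ne <| by
    rw [hbot, Set.pair_comm] at hx
    exact ((isLUB_pair_of_le bot_le).unique hx)
  exact ⟨c, hc, hcd.trans (hx.1 (.inr rfl)), orth_of_le (hd.1 (.inl rfl)) hcd⟩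

theorem exists_isBlock_superset [Finite L] {S : Set L} (hS : IsOrthogonalAtomSet S) :
    ∃ B, S ⊆ B ∧ IsBlock B :=
  Finite.exists_le_maximal hS

/-- The orthogonality graph on the atoms. -/
def orthGraph (L : Type u) [OrthomodularPoset L] : SimpleGraph {a : L // IsAtom a} where
  Adj a b := Orth a.1 b.1
  symm := ⟨fun _ _ h => h.symm⟩
  loopless := ⟨fun a h => not_orth_self a.2 h⟩

theorem isOrthogonalAtomSet_image_iff {S : Set {a : L // IsAtom a}} :
    IsOrthogonalAtomSet (Subtype.val '' S) ↔ (orthGraph L).IsClique S := by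
  constructor
  · intro h a ha b hb hab
    exact h.2 ⟨a, ha, rfl⟩ ⟨b, hb, rfl⟩ (Subtype.val_injective.ne hab)
  · intro h
    refine ⟨?_, ?_⟩
    · rintro _ ⟨a, -, rfl⟩
      exact a.2
    · rintro _ ⟨a, ha, rfl⟩ _ ⟨b, hb, rfl⟩ hab
      exact h ha hb fun e => hab (congrArg _ e)

theorem exists_isBlock_of_adj [Finite L] {a b : {a : L // IsAtom a}} (h : (orthGraph L).Adj a b) :
    ∃ B, IsBlock B ∧ a.1 ∈ B ∧ b.1 ∈ B := by
  have hS : IsOrthogonalAtomSet (Subtype.val '' {a, b}) :=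
    isOrthogonalAtomSet_image_iff.2 (by simp [Set.pairwise_insert, SimpleGraph.IsClique, h, h.symm])
  obtain ⟨B, hSB, hBB⟩ := exists_isBlock_superset hS
  exact ⟨B, hBB, hSB ⟨a, by simp, rfl⟩, hSB ⟨b, by simp, rfl⟩⟩

section ThreeElementBlocks

variable (hB : ∀ B : Set L, IsBlock B → B.encard = 3)
include hB

/-- If every block has three elements then every element is a bound, an atom or the complement of
an atom: otherwise there would be two orthogonal atoms below it and two below its complement. -/
theorem eq_bot_or_eq_top_or_isAtom [Finite L] (x : L) : x = ⊥ ∨ x = ⊤ ∨ IsAtom x ∨ IsAtom xᶜ := by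
  by_contra! ⟨h₀, h₁, h₂, h₃⟩
  have h₁' : xᶜ ≠ ⊥ := fun h => h₁ (by rw [← compl_compl' x, h, bot_compl])
  obtain ⟨a, ha, hax⟩ := exists_atom_le h₀
  obtain ⟨b, hb, hbx⟩ := exists_atom_le h₁'
  obtain ⟨c, hc, hcx, hac⟩ := exists_atom_orth (lt_of_le_of_ne hax fun h => h₂ (h ▸ ha))
  obtain ⟨d, hd, hdx, hbd⟩ := exists_atom_orth (lt_of_le_of_ne hbx fun h => h₃ (h ▸ hb))
  have hab := orth_of_le hax hbx
  have had := orth_of_le hax hdx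
  have hcb := orth_of_le hcx hbx
  have hcd := orth_of_le hcx hdx
  have ne : ∀ {p q : L}, IsAtom p → Orth p q → p ≠ q := fun hp h e => not_orth_self hp (e ▸ h)
  have hS : IsOrthogonalAtomSet ({a, c, b, d} : Set L) := by
    refine ⟨?_, ?_⟩
    · rintro y (rfl | rfl | rfl | rfl) <;> assumption
    · rintro y (rfl | rfl | rfl | rfl) z (rfl | rfl | rfl | rfl) h <;>
        first | exact (h rfl).elim | assumption | (apply Orth.symm; assumption)
  obtain ⟨B, hSB, hBB⟩ := exists_isBlock_superset hS
  have h := Set.encard_le_encard hSB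
  rw [hB B hBB, Set.encard_insert_of_notMem (by
      simp [ne ha hac, ne ha hab, ne ha had]), Set.encard_insert_of_notMem (by
      simp [ne hc hcb, ne hc hcd]), Set.encard_pair (ne hb hbd)] at h
  norm_num at h

theorem isBlock_eq_triple {B : Set L} (h : IsBlock B) {a : {a : L // IsAtom a}} (ha : a.1 ∈ B) :
    ∃ b c, (orthGraph L).Adj a b ∧ (orthGraph L).Adj a c ∧ (orthGraph L).Adj b c ∧
      B = {a.1, b.1, c.1} := by
  have h₂ : (B \ {a.1}).encard = 2 := by
    have := Set.encard_sdiff_singleton_add_one ha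
    rw [hB B h] at this
    exact WithTop.add_right_cancel ENat.one_ne_top (this.trans (by norm_num : (3 : ℕ∞) = 2 + 1))
  obtain ⟨b, c, hbc, e⟩ := Set.encard_eq_two.1 h₂
  have hb : b ∈ B \ {a.1} := by simp [e]
  have hc : c ∈ B \ {a.1} := by simp [e]
  refine ⟨⟨b, h.prop.1 b hb.1⟩, ⟨c, h.prop.1 c hc.1⟩, h.prop.2 ha hb.1 (Ne.symm hb.2),
    h.prop.2 ha hc.1 (Ne.symm hc.2), h.prop.2 hb.1 hc.1 hbc, ?_⟩
  rw [← e, Set.insert_sdiff_singleton, Set.insert_eq_of_mem ha]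

theorem uniqueTriangles_orthGraph [Finite L] : UniqueTriangles (orthGraph L) where
  exists_adj a := by
    have hS : IsOrthogonalAtomSet (Subtype.val '' {a}) :=
      isOrthogonalAtomSet_image_iff.2 (by simp)
    obtain ⟨B, hSB, hBB⟩ := exists_isBlock_superset hS
    obtain ⟨b, _, hb, _⟩ := isBlock_eq_triple hB hBB (hSB ⟨a, rfl, rfl⟩)
    exact ⟨b, hb⟩
  existsUnique_third a b hab := by
    obtain ⟨B, hBB, haB, hbB⟩ := exists_isBlock_of_adj hab
    have ex : ∃ c, (orthGraph L).Adj a c ∧ (orthGraph L).Adj b c := by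
      obtain ⟨p, q, hap, haq, hpq, rfl⟩ := isBlock_eq_triple hB hBB haB
      rcases hbB with h | h | h
      · exact (hab.ne (Subtype.ext h.symm)).elim
      · obtain rfl : b = p := Subtype.ext h
        exact ⟨q, haq, hpq⟩
      · obtain rfl : b = q := Subtype.ext h
        exact ⟨p, hap, hpq.symm⟩
    obtain ⟨x, hx⟩ := exists_isLUB' a.1 b.1 hab
    have hle : ∀ c, (orthGraph L).Adj a c ∧ (orthGraph L).Adj b c → c.1 ≤ xᶜ := fun c hc =>
      Orth.symm (show x ≤ c.1ᶜ from hx.2 (by rintro y (rfl | rfl); exacts [hc.1, hc.2]))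
    -- `xᶜ` is the third atom: it lies above an atom, and `x` lies above two distinct ones
    have hxat : IsAtom xᶜ := by
      obtain ⟨c, hc⟩ := ex
      rcases eq_bot_or_eq_top_or_isAtom hB x with h | h | h | h
      · exact (a.2.1 (le_bot_iff.1 (h ▸ hx.1 (.inl rfl)))).elim
      · have := hle c hc
        rw [h, top_compl] at this
        exact (c.2.1 (le_bot_iff.1 this)).elim
      · have h₁ := (h.le_iff.1 (hx.1 (.inl rfl))).resolve_left a.2.1
        have h₂ := (h.le_iff.1 (hx.1 (.inr rfl))).resolve_left b.2.1
        exact (hab.ne (Subtype.ext (h₁.trans h₂.symm))).elim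
      · exact h
    have heq : ∀ c, (orthGraph L).Adj a c ∧ (orthGraph L).Adj b c → c.1 = xᶜ := fun c hc =>
      (hxat.le_iff.1 (hle c hc)).resolve_left c.2.1
    obtain ⟨c, hc⟩ := ex
    exact ⟨c, hc, fun d hd => Subtype.ext ((heq d hd).trans (heq c hc).symm)⟩

/-- An atom that lies in exactly three blocks is orthogonal to exactly six atoms. -/
theorem exists_finset_adj [Finite L] {a : {a : L // IsAtom a}}
    (h₃ : {B : Set L | IsBlock B ∧ a.1 ∈ B}.encard = 3) :
    ∃ s : Finset {a : L // IsAtom a}, s.card = 6 ∧ ∀ b, b ∈ s ↔ (orthGraph L).Adj a b := by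
  classical
  have := uniqueTriangles_orthGraph hB
  obtain ⟨B₁, B₂, B₃, h₁₂, h₁₃, h₂₃, e⟩ := Set.encard_eq_three.1 h₃
  have hm : ∀ B, (IsBlock B ∧ a.1 ∈ B) ↔ B = B₁ ∨ B = B₂ ∨ B = B₃ := fun B => by
    simpa using Set.ext_iff.1 e B
  have hB₁ := (hm B₁).2 (by simp)
  have hB₂ := (hm B₂).2 (by simp)
  have hB₃ := (hm B₃).2 (by simp)
  obtain ⟨x₁, y₁, hx₁, hy₁, h₁, rfl⟩ := isBlock_eq_triple hB hB₁.1 hB₁.2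
  obtain ⟨x₂, y₂, hx₂, hy₂, h₂, rfl⟩ := isBlock_eq_triple hB hB₂.1 hB₂.2
  obtain ⟨x₃, y₃, hx₃, hy₃, h₃, rfl⟩ := isBlock_eq_triple hB hB₃.1 hB₃.2
  -- triangles through `a` with another common vertex coincide
  have key : ∀ {x y z w}, (orthGraph L).Adj a x → (orthGraph L).Adj a y → (orthGraph L).Adj x y →
      (orthGraph L).Adj a z → (orthGraph L).Adj a w → (orthGraph L).Adj z w →
      ({a.1, x.1, y.1} : Set L) ≠ {a.1, z.1, w.1} → x ≠ z ∧ x ≠ w ∧ y ≠ z ∧ y ≠ w := by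
    intro x y z w hx hy hxy hz hw hzw hne
    refine ⟨?_, ?_, ?_, ?_⟩ <;> rintro rfl <;> apply hne
    · rw [third_unique hx hy hxy hw hzw]
    · rw [third_unique hx hy hxy hz hzw.symm, Set.pair_comm]
    · rw [third_unique hy hx hxy.symm hw hzw, Set.pair_comm]
    · rw [third_unique hy hx hxy.symm hz hzw.symm]
  obtain ⟨n₁, n₂, n₃, n₄⟩ := key hx₁ hy₁ h₁ hx₂ hy₂ h₂ h₁₂
  obtain ⟨n₅, n₆, n₇, n₈⟩ := key hx₁ hy₁ h₁ hx₃ hy₃ h₃ h₁₃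
  obtain ⟨n₉, n₁₀, n₁₁, n₁₂⟩ := key hx₂ hy₂ h₂ hx₃ hy₃ h₃ h₂₃
  refine ⟨{x₁, y₁, x₂, y₂, x₃, y₃}, ?_, fun b => ⟨?_, fun hb => ?_⟩⟩
  · rw [Finset.card_insert_of_notMem, Finset.card_insert_of_notMem, Finset.card_insert_of_notMem,
      Finset.card_insert_of_notMem, Finset.card_pair h₃.ne] <;>
      simp [*, h₁.ne, h₂.ne]
  · simp only [Finset.mem_insert, Finset.mem_singleton]
    rintro (rfl | rfl | rfl | rfl | rfl | rfl) <;> assumption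
  · obtain ⟨B, hBB, haB, hbB⟩ := exists_isBlock_of_adj hb
    have hba : b.1 ≠ a.1 := fun e => hb.ne (Subtype.ext e.symm)
    rcases (hm B).1 ⟨hBB, haB⟩ with rfl | rfl | rfl <;>
      rcases hbB with h | h | h <;> first | exact (hba h).elim | simp [Subtype.ext h]

end ThreeElementBlocks

end OrthomodularPoset

/-! ### Uniqueness of the generalized quadrangle of order (2, 2) -/

/-- The vertices of the doily, as pairs of points of a six-element set. -/
def duad : Fin 15 → Finset (Fin 6) :=
  ![{0, 1}, {2, 3}, {4, 5}, {2, 4}, {3, 5}, {3, 4}, {2, 5}, {1, 5}, {0, 4}, {0, 5}, {1, 4},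
    {0, 3}, {1, 2}, {1, 3}, {0, 2}]

/-- The collinearity graph of the generalized quadrangle of order `(2, 2)`: its vertices are the
pairs of points of a six-element set, disjoint pairs being adjacent. -/
def doily : SimpleGraph (Fin 15) where
  Adj i j := Disjoint (duad i) (duad j)
  symm := ⟨fun _ _ h => h.symm⟩
  loopless := ⟨by decide⟩

instance : DecidableRel doily.Adj :=
  fun i j => inferInstanceAs (Decidable (Disjoint (duad i) (duad j)))

instance : UniqueTriangles doily where
  exists_adj := by decide +kernel
  existsUnique_third := by
    have h : ∀ i j, doily.Adj i j → ∃ k, (doily.Adj i k ∧ doily.Adj j k) ∧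
        ∀ l, doily.Adj i l → doily.Adj j l → l = k := by decide +kernel
    intro i j hij
    obtain ⟨k, hk, hu⟩ := h i j hij
    exact ⟨k, hk, fun l hl => hu l hl.1 hl.2⟩

/-- The fifteen triangles of the doily. -/
def doilyLine : Fin 15 → Fin 15 × Fin 15 × Fin 15 :=
  ![(0, 1, 2), (0, 3, 4), (0, 5, 6), (1, 7, 8), (1, 9, 10), (2, 11, 12), (2, 13, 14), (3, 7, 11),
    (3, 9, 13), (4, 8, 12), (4, 10, 14), (5, 7, 14), (5, 9, 12), (6, 8, 13), (6, 10, 11)]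

theorem exists_doilyLine : ∀ i j, doily.Adj i j → ∃ k,
    (i = (doilyLine k).1 ∨ i = (doilyLine k).2.1 ∨ i = (doilyLine k).2.2) ∧
    (j = (doilyLine k).1 ∨ j = (doilyLine k).2.1 ∨ j = (doilyLine k).2.2) := by
  decide +kernel

theorem exists_common_adj : ∀ i j, i ≠ j → ¬ doily.Adj i j →
    ∃ k l, doily.Adj i k ∧ doily.Adj i l ∧ doily.Adj k l ∧ doily.Adj j k := by
  decide +kernel

section Triangles

variable {V : Type u} {G : SimpleGraph V} [UniqueTriangles G]

theorem not_adj_of_triangle {a b c p : V} (hab : G.Adj a b) (hac : G.Adj a c) (hbc : G.Adj b c)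
    (hap : G.Adj a p) (hpc : p ≠ c) : ¬ G.Adj b p :=
  fun h => hpc (third_unique hab hap h hac hbc)

theorem eq_or_eq_of_triangles {a b c x x' : V} (hab : G.Adj a b) (hac : G.Adj a c)
    (hbc : G.Adj b c) (hx : G.Adj a x) (hx' : G.Adj a x') (hxx' : G.Adj x x')
    (h : x = b ∨ x = c) : x' = b ∨ x' = c := by
  rcases h with rfl | rfl
  · exact .inr (third_unique hx hx' hxx' hac hbc)
  · exact .inl (third_unique hx hx' hxx' hab hbc.symm)

end Triangles

section Quadrangle

variable {V : Type u} [Fintype V] [DecidableEq V] {G : SimpleGraph V} [DecidableRel G.Adj]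
  [UniqueTriangles G] (hcard : Fintype.card V = 15) (hdeg : ∀ v, (G.neighborFinset v).card = 6)
include hdeg

/-- The three triangles at a vertex. -/
theorem mem_of_adj_of_triangles {a b c x x' y y' : V} (hab : G.Adj a b) (hac : G.Adj a c)
    (hbc : G.Adj b c) (hax : G.Adj a x) (hax' : G.Adj a x') (hxx' : G.Adj x x') (hay : G.Adj a y)
    (hay' : G.Adj a y') (hyy' : G.Adj y y') (hx : x ≠ b ∧ x ≠ c)
    (hy : y ≠ b ∧ y ≠ c ∧ y ≠ x ∧ y ≠ x') {q : V} (hq : G.Adj a q) :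
    q = b ∨ q = c ∨ q = x ∨ q = x' ∨ q = y ∨ q = y' := by
  have tu : ∀ a b c d, G.Adj a b → G.Adj a c → G.Adj b c → G.Adj a d → G.Adj b d → c = d :=
    fun a b c d => third_unique
  have sy : ∀ a b, G.Adj a b → G.Adj b a := fun a b h => h.symm
  have hsub : ({b, c, x, x', y, y'} : Finset V) ⊆ G.neighborFinset a := by
    intro z
    simp only [Finset.mem_insert, Finset.mem_singleton, SimpleGraph.mem_neighborFinset]
    rintro (rfl | rfl | rfl | rfl | rfl | rfl) <;> assumption
  have hb := hbc.ne
  have hx' : x' ≠ b ∧ x' ≠ c := by grind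
  have hy' : y' ≠ b ∧ y' ≠ c ∧ y' ≠ x ∧ y' ≠ x' := by grind
  have h6 : ({b, c, x, x', y, y'} : Finset V).card = 6 := by
    rw [Finset.card_insert_of_notMem, Finset.card_insert_of_notMem, Finset.card_insert_of_notMem,
      Finset.card_insert_of_notMem, Finset.card_pair hyy'.ne] <;>
      simp [hb, hx.1.symm, hx.2.symm, hx'.1.symm, hx'.2.symm, hxx'.ne, hy.1.symm, hy.2.1.symm,
        hy.2.2.1.symm, hy.2.2.2.symm, hy'.1.symm, hy'.2.1.symm, hy'.2.2.1.symm, hy'.2.2.2.symm]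
  have := Finset.eq_of_subset_of_card_le hsub (by rw [h6, hdeg])
  have hq' : q ∈ G.neighborFinset a := by simpa using hq
  rw [← this] at hq'
  simpa using hq'

include hcard

/-- In a graph with unique triangles, `15` vertices and degree `6`, the neighbourhoods of the three
vertices of a triangle cover everything: `3 + 3 * 4 = 15`. -/
theorem adj_of_triangle {a b c : V} (hab : G.Adj a b) (hac : G.Adj a c) (hbc : G.Adj b c) (p : V) :
    p = a ∨ p = b ∨ p = c ∨ G.Adj a p ∨ G.Adj b p ∨ G.Adj c p := by
  have card4 : ∀ {a b c : V}, G.Adj a b → G.Adj a c → G.Adj b c →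
      (((G.neighborFinset a).erase b).erase c).card = 4 := by
    intro a b c hab hac hbc
    rw [Finset.card_erase_of_mem (by simp [hac, hbc.ne.symm]), Finset.card_erase_of_mem (by simpa),
      hdeg]
  have tu : ∀ a b c d, G.Adj a b → G.Adj a c → G.Adj b c → G.Adj a d → G.Adj b d → c = d :=
    fun a b c d => third_unique
  have sy : ∀ a b, G.Adj a b → G.Adj b a := fun a b h => h.symm
  have irr : ∀ a, ¬ G.Adj a a := fun a => G.irrefl
  let S := ({a, b, c} : Finset V) ∪ (((G.neighborFinset a).erase b).erase c ∪
    (((G.neighborFinset b).erase a).erase c ∪ ((G.neighborFinset c).erase a).erase b))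
  have hS : S.card = 15 := by
    rw [Finset.card_union_of_disjoint, Finset.card_union_of_disjoint, Finset.card_union_of_disjoint,
      card4 hab hac hbc, card4 hab.symm hbc hac, card4 hac.symm hbc.symm hab,
      Finset.card_eq_three.2 ⟨a, b, c, hab.ne, hac.ne, hbc.ne, rfl⟩]
    all_goals
      rw [Finset.disjoint_left]
      intro z
      simp only [Finset.mem_union, Finset.mem_erase, SimpleGraph.mem_neighborFinset,
        Finset.mem_insert, Finset.mem_singleton]
      grind
  have hu : S = Finset.univ := Finset.eq_univ_of_card _ (by rw [hS, hcard])
  have hp : p ∈ S := hu ▸ Finset.mem_univ p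
  simp only [S, Finset.mem_union, Finset.mem_erase, SimpleGraph.mem_neighborFinset,
    Finset.mem_insert, Finset.mem_singleton] at hp
  grind

/-- A vertex `p` that is not adjacent to `a` has a neighbour on a triangle through `a` outside any
given union `s` of at most two such triangles. -/
theorem exists_triangle_adj {a p : V} (hpa : p ≠ a) (hp : ¬ G.Adj a p) (s : Finset V)
    (hs : s.card ≤ 4)
    (hclosed : ∀ x x', G.Adj a x → G.Adj a x' → G.Adj x x' → x ∈ s → x' ∈ s) :
    ∃ x x', G.Adj a x ∧ G.Adj a x' ∧ G.Adj x x' ∧ G.Adj p x ∧ x ∉ s := by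
  obtain ⟨x, hx, hxs⟩ : ∃ x ∈ G.neighborFinset a, x ∉ s :=
    Finset.exists_mem_notMem_of_card_lt_card (by rw [hdeg]; omega)
  rw [SimpleGraph.mem_neighborFinset] at hx
  obtain ⟨x', hx', hxx'⟩ := exists_third hx
  rcases adj_of_triangle hcard hdeg hx hx' hxx' p with h | rfl | rfl | h | h | h
  · exact (hpa h).elim
  · exact (hp hx).elim
  · exact (hp hx').elim
  · exact (hp h).elim
  · exact ⟨x, x', hx, hx', hxx', h.symm, hxs⟩
  · exact ⟨x', x, hx', hx, hxx'.symm, h.symm, fun h' => hxs (hclosed x' x hx' hx hxx'.symm h')⟩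

/-- A vertex `p` that is not adjacent to `l` is adjacent to exactly one further vertex of each
triangle through `l`. -/
theorem adj_iff_not_adj {l u u' p : V} (hu : G.Adj l u) (hu' : G.Adj l u') (huu' : G.Adj u u')
    (h : p ≠ l ∧ ¬ G.Adj l p) : G.Adj p u ↔ ¬ G.Adj p u' := by
  constructor
  · exact fun h₁ h₂ => h.1 (third_unique huu' h₁.symm h₂.symm hu.symm hu'.symm)
  · intro h₁
    rcases adj_of_triangle hcard hdeg hu hu' huu' p with h₂ | rfl | rfl | h₂ | h₂ | h₂
    · exact (h.1 h₂).elim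
    · exact (h.2 hu).elim
    · exact (h.2 hu').elim
    · exact (h.2 h₂).elim
    · exact h₂.symm
    · exact (h₁ h₂.symm).elim

/-- Let `l x x'` and `l' y y'` be triangles such that `x` and `x'` are not adjacent to `l'`, and `y`
is not adjacent to `l`. Then the edges between `{x, x'}` and `{y, y'}` form a perfect matching. -/
theorem adj_and_adj_or {l x x' l' y y' : V} (hx : G.Adj l x) (hx' : G.Adj l x')
    (hxx' : G.Adj x x') (hy : G.Adj l' y) (hy' : G.Adj l' y') (hyy' : G.Adj y y')
    (ox : x ≠ l' ∧ ¬ G.Adj l' x) (ox' : x' ≠ l' ∧ ¬ G.Adj l' x') (oy : y ≠ l ∧ ¬ G.Adj l y) :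
    (G.Adj x y ∧ G.Adj x' y' ∧ ¬ G.Adj x y') ∨ (G.Adj x y' ∧ G.Adj x' y ∧ ¬ G.Adj x y) := by
  have h₁ := adj_iff_not_adj hcard hdeg hx hx' hxx' oy
  have h₂ := adj_iff_not_adj hcard hdeg hy hy' hyy' ox
  have h₃ := adj_iff_not_adj hcard hdeg hy hy' hyy' ox'
  rw [G.adj_comm y x, G.adj_comm y x'] at h₁
  by_cases h : G.Adj x y
  · exact .inl ⟨h, not_not.1 fun h' => h₁.1 h (h₃.2 h'), h₂.1 h⟩
  · exact .inr ⟨not_not.1 fun h' => h (h₂.2 h'), not_not.1 fun h' => h (h₁.2 h'), h⟩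

/-- The vertices can be labelled by the vertices of the doily in such a way that adjacency is
preserved. -/
theorem exists_labelling : ∃ f : Fin 15 → V, Function.Surjective f ∧
    ∀ i j, doily.Adj i j → G.Adj (f i) (f j) := by
  have : Nonempty V := Fintype.card_pos_iff.1 (by omega)
  obtain ⟨a⟩ := this
  obtain ⟨b, hab⟩ := exists_adj G a
  obtain ⟨c, hac, hbc⟩ := exists_third hab
  -- the vertices off the triangle `a b c` fall into three classes, according to their neighbour
  have clsA : ∀ p, G.Adj a p → p ≠ b → p ≠ c → (p ≠ b ∧ ¬ G.Adj b p) ∧ (p ≠ c ∧ ¬ G.Adj c p) :=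
    fun p hp h₁ h₂ => ⟨⟨h₁, not_adj_of_triangle hab hac hbc hp h₂⟩,
      ⟨h₂, not_adj_of_triangle hac hab hbc.symm hp h₁⟩⟩
  have clsB : ∀ p, G.Adj b p → p ≠ a → p ≠ c → (p ≠ a ∧ ¬ G.Adj a p) ∧ (p ≠ c ∧ ¬ G.Adj c p) :=
    fun p hp h₁ h₂ => ⟨⟨h₁, not_adj_of_triangle hab.symm hbc hac hp h₂⟩,
      ⟨h₂, not_adj_of_triangle hbc hab.symm hac.symm hp h₁⟩⟩
  have clsC : ∀ p, G.Adj c p → p ≠ a → p ≠ b → (p ≠ a ∧ ¬ G.Adj a p) ∧ (p ≠ b ∧ ¬ G.Adj b p) :=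
    fun p hp h₁ h₂ => ⟨⟨h₁, not_adj_of_triangle hac.symm hbc.symm hab hp h₂⟩,
      ⟨h₂, not_adj_of_triangle hbc.symm hac.symm hab.symm hp h₁⟩⟩
  have third_ne : ∀ {l m n x x'}, G.Adj l m → G.Adj l n → G.Adj m n → G.Adj l x → G.Adj l x' →
      G.Adj x x' → x ≠ m → x ≠ n → x' ≠ m ∧ x' ≠ n := by
    intro l m n x x' hm hn hmn hx hx' hxx' h₁ h₂
    rw [← not_or]
    exact fun h => (eq_or_eq_of_triangles hm hn hmn hx' hx hxx'.symm h).elim h₁ h₂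
  obtain ⟨a₁, ha₁, ha₁s⟩ : ∃ x ∈ G.neighborFinset a, x ∉ ({b, c} : Finset V) :=
    Finset.exists_mem_notMem_of_card_lt_card (by
      rw [hdeg]
      exact Finset.card_le_two.trans_lt (by norm_num))
  rw [SimpleGraph.mem_neighborFinset] at ha₁
  simp only [Finset.mem_insert, Finset.mem_singleton, not_or] at ha₁s
  obtain ⟨a₁', ha₁', haa₁⟩ := exists_third ha₁
  have ha₁s' := third_ne hab hac hbc ha₁ ha₁' haa₁ ha₁s.1 ha₁s.2
  have A₁ := clsA a₁ ha₁ ha₁s.1 ha₁s.2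
  have A₁' := clsA a₁' ha₁' ha₁s'.1 ha₁s'.2
  obtain ⟨b₁, b₁', hb₁, hb₁', hbb₁, hab₁₁, hb₁s⟩ := exists_triangle_adj hcard hdeg A₁.1.1 A₁.1.2
    {a, c} (Finset.card_le_two.trans (by norm_num)) (by
      simp only [Finset.mem_insert, Finset.mem_singleton]
      exact fun x x' hx hx' hxx' => eq_or_eq_of_triangles hab.symm hbc hac hx hx' hxx')
  simp only [Finset.mem_insert, Finset.mem_singleton, not_or] at hb₁s
  obtain ⟨b₂, b₂', hb₂, hb₂', hbb₂, hab₁₂, hb₂s⟩ := exists_triangle_adj hcard hdeg A₁.1.1 A₁.1.2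
    {a, c, b₁, b₁'} Finset.card_le_four (by
      simp only [Finset.mem_insert, Finset.mem_singleton]
      intro x x' hx hx' hxx'
      have h₁ := eq_or_eq_of_triangles hab.symm hbc hac hx hx' hxx'
      have h₂ := eq_or_eq_of_triangles hb₁ hb₁' hbb₁ hx hx' hxx'
      exact fun h => or_assoc.1 ((or_assoc.2 h).imp h₁ h₂))
  simp only [Finset.mem_insert, Finset.mem_singleton, not_or] at hb₂s
  have hb₁s' := third_ne hab.symm hbc hac hb₁ hb₁' hbb₁ hb₁s.1 hb₁s.2
  have hb₂s' := third_ne hab.symm hbc hac hb₂ hb₂' hbb₂ hb₂s.1 hb₂s.2.1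
  have B₁ := clsB b₁ hb₁ hb₁s.1 hb₁s.2
  have B₁' := clsB b₁' hb₁' hb₁s'.1 hb₁s'.2
  have B₂ := clsB b₂ hb₂ hb₂s.1 hb₂s.2.1
  have B₂' := clsB b₂' hb₂' hb₂s'.1 hb₂s'.2
  obtain ⟨a₂, a₂', ha₂, ha₂', haa₂, hba₁₂, ha₂s⟩ := exists_triangle_adj hcard hdeg B₁.1.1 B₁.1.2
    {b, c, a₁, a₁'} Finset.card_le_four (by
      simp only [Finset.mem_insert, Finset.mem_singleton]
      intro x x' hx hx' hxx'
      have h₁ := eq_or_eq_of_triangles hab hac hbc hx hx' hxx'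
      have h₂ := eq_or_eq_of_triangles ha₁ ha₁' haa₁ hx hx' hxx'
      exact fun h => or_assoc.1 ((or_assoc.2 h).imp h₁ h₂))
  simp only [Finset.mem_insert, Finset.mem_singleton, not_or] at ha₂s
  have ha₂s' := third_ne hab hac hbc ha₂ ha₂' haa₂ ha₂s.1 ha₂s.2.1
  have A₂ := clsA a₂ ha₂ ha₂s.1 ha₂s.2.1
  have A₂' := clsA a₂' ha₂' ha₂s'.1 ha₂s'.2
  -- a triangle that meets the first two classes meets the third one
  have transversal : ∀ {x y z}, G.Adj a x → (x ≠ b ∧ ¬ G.Adj b x) → (x ≠ c ∧ ¬ G.Adj c x) →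
      G.Adj b y → (y ≠ a ∧ ¬ G.Adj a y) → G.Adj x y → G.Adj x z → G.Adj y z →
      G.Adj c z ∧ z ≠ a ∧ z ≠ b := by
    intro x y z hx hxb hxc hy hya hxy hxz hyz
    have hza : z ≠ a := fun h => hya.2 (h ▸ hyz.symm)
    have hzb : z ≠ b := fun h => hxb.2 (h ▸ hxz.symm)
    have hzc : z ≠ c := fun h => hxc.2 (h ▸ hxz.symm)
    have haz : ¬ G.Adj a z := fun h => hya.1 (third_unique hxz hxy hyz.symm hx.symm h.symm)
    have hbz : ¬ G.Adj b z := fun h => hxb.1 (third_unique hyz hxy.symm hxz.symm hy.symm h.symm)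
    rcases adj_of_triangle hcard hdeg hab hac hbc z with h | h | h | h | h | h
    exacts [(hza h).elim, (hzb h).elim, (hzc h).elim, (haz h).elim, (hbz h).elim, ⟨h, hza, hzb⟩]
  obtain ⟨c₁, hac₁₁, hbc₁₁⟩ := exists_third hab₁₁
  obtain ⟨c₂, hac₁₂, hbc₂₂⟩ := exists_third hab₁₂
  obtain ⟨hc₁, hc₁a, hc₁b⟩ := transversal ha₁ A₁.1 A₁.2 hb₁ B₁.1 hab₁₁ hac₁₁ hbc₁₁
  obtain ⟨hc₂, hc₂a, hc₂b⟩ := transversal ha₁ A₁.1 A₁.2 hb₂ B₂.1 hab₁₂ hac₁₂ hbc₂₂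
  obtain ⟨c₁', hc₁', hcc₁⟩ := exists_third hc₁
  obtain ⟨c₂', hc₂', hcc₂⟩ := exists_third hc₂
  have hc₁s' := third_ne hac.symm hbc.symm hab hc₁ hc₁' hcc₁ hc₁a hc₁b
  have hc₂s' := third_ne hac.symm hbc.symm hab hc₂ hc₂' hcc₂ hc₂a hc₂b
  have C₁ := clsC c₁ hc₁ hc₁a hc₁b
  have C₁' := clsC c₁' hc₁' hc₁s'.1 hc₁s'.2
  have C₂ := clsC c₂ hc₂ hc₂a hc₂b
  have C₂' := clsC c₂' hc₂' hc₂s'.1 hc₂s'.2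
  have a₂'_ne := third_ne ha₁ ha₁' haa₁ ha₂ ha₂' haa₂ ha₂s.2.2.1 ha₂s.2.2.2
  have link := @adj_and_adj_or V _ _ G _ _ hcard hdeg
  -- the links of the six triangles that meet `a b c` in one vertex
  obtain ⟨-, l₁, -⟩ := (link ha₁ ha₁' haa₁ hb₁ hb₁' hbb₁ A₁.1 A₁'.1 B₁.1).resolve_right
    fun h => h.2.2 hab₁₁
  obtain ⟨-, l₂, -⟩ := (link ha₁ ha₁' haa₁ hb₂ hb₂' hbb₂ A₁.1 A₁'.1 B₂.1).resolve_right
    fun h => h.2.2 hab₁₂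
  obtain ⟨-, l₃, n₃⟩ := (link ha₁ ha₁' haa₁ hc₁ hc₁' hcc₁ A₁.2 A₁'.2 C₁.1).resolve_right
    fun h => h.2.2 hac₁₁
  obtain ⟨-, l₄, -⟩ := (link ha₁ ha₁' haa₁ hc₂ hc₂' hcc₂ A₁.2 A₁'.2 C₂.1).resolve_right
    fun h => h.2.2 hac₁₂
  obtain ⟨-, l₅, n₅⟩ := (link hb₁ hb₁' hbb₁ hc₁ hc₁' hcc₁ B₁.2 B₁'.2 C₁.2).resolve_right
    fun h => h.2.2 hbc₁₁
  obtain ⟨-, l₆, -⟩ := (link hb₂ hb₂' hbb₂ hc₂ hc₂' hcc₂ B₂.2 B₂'.2 C₂.2).resolve_right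
    fun h => h.2.2 hbc₂₂
  obtain ⟨-, l₇, -⟩ := (link ha₂ ha₂' haa₂ hb₁ hb₁' hbb₁ A₂.1 A₂'.1 B₁.1).resolve_right
    fun h => h.2.2 hba₁₂.symm
  have c₂_ne : c₂ ≠ c₁ ∧ c₂ ≠ c₁' := by
    constructor
    · rintro rfl
      exact hb₂s.2.2.1 (third_unique hac₁₂ hab₁₂ hbc₂₂.symm hab₁₁ hbc₁₁.symm)
    · rintro rfl
      exact n₃ hac₁₂
  have n₈ : ¬ G.Adj b₁ c₂ := fun h => c₂_ne.1 (third_unique hab₁₁ hac₁₂ h hac₁₁ hbc₁₁)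
  obtain ⟨l₈, l₈', -⟩ := (link hb₁ hb₁' hbb₁ hc₂ hc₂' hcc₂ B₁.2 B₁'.2 C₂.2).resolve_left
    fun h => n₈ h.1
  obtain ⟨l₉, l₉', -⟩ := (link hb₂ hb₂' hbb₂ hc₁ hc₁' hcc₁ B₂.2 B₂'.2 C₁.2).resolve_left
    fun h => c₂_ne.1 (third_unique hab₁₂ hac₁₂ hbc₂₂ hac₁₁ h.1)
  obtain ⟨m₁, m₁', n₁⟩ := (link ha₂ ha₂' haa₂ hc₁ hc₁' hcc₁ A₂.2 A₂'.2 C₁.1).resolve_left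
    fun h => ha₂s.2.2.1 (third_unique hbc₁₁ hba₁₂ h.1.symm hab₁₁.symm hac₁₁.symm)
  have nbrC : ∀ {q}, G.Adj c q → q = a ∨ q = b ∨ q = c₁ ∨ q = c₁' ∨ q = c₂ ∨ q = c₂' :=
    mem_of_adj_of_triangles hdeg hac.symm hbc.symm hab hc₁ hc₁' hcc₁ hc₂ hc₂' hcc₂ ⟨hc₁a, hc₁b⟩
      ⟨hc₂a, hc₂b, c₂_ne⟩
  have m₂ : G.Adj a₂ c₂' := by
    obtain ⟨z, hz, hz'⟩ := exists_third hba₁₂.symm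
    obtain ⟨hcz, hza, hzb⟩ := transversal ha₂ A₂.1 A₂.2 hb₁ B₁.1 hba₁₂.symm hz hz'
    rcases nbrC hcz with rfl | rfl | rfl | rfl | rfl | rfl
    exacts [(hza rfl).elim, (hzb rfl).elim, (n₁ hz).elim, (n₅ hz').elim, (n₈ hz').elim, hz]
  obtain ⟨-, m₂', -⟩ := (link ha₂ ha₂' haa₂ hc₂' hc₂ hcc₂.symm A₂.2 A₂'.2 C₂'.1).resolve_right
    fun h => h.2.2 m₂
  obtain ⟨m₃, m₃', -⟩ := (link ha₂ ha₂' haa₂ hb₂ hb₂' hbb₂ A₂.1 A₂'.1 B₂.1).resolve_right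
    fun h => a₂'_ne.1 (third_unique hbc₂₂ h.2.1.symm m₂'.symm hab₁₂.symm hac₁₂.symm)
  have nbrA : ∀ {q}, G.Adj a q → q = b ∨ q = c ∨ q = a₁ ∨ q = a₁' ∨ q = a₂ ∨ q = a₂' :=
    mem_of_adj_of_triangles hdeg hab hac hbc ha₁ ha₁' haa₁ ha₂ ha₂' haa₂ ha₁s ha₂s
  have nbrB : ∀ {q}, G.Adj b q → q = a ∨ q = c ∨ q = b₁ ∨ q = b₁' ∨ q = b₂ ∨ q = b₂' :=
    mem_of_adj_of_triangles hdeg hab.symm hbc hac hb₁ hb₁' hbb₁ hb₂ hb₂' hbb₂ hb₁s hb₂s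
  let f : Fin 15 → V := ![a, b, c, a₁, a₁', a₂, a₂', b₁, b₁', b₂, b₂', c₁, c₁', c₂, c₂']
  have hf : ∀ k, G.Adj (f (doilyLine k).1) (f (doilyLine k).2.1) ∧
      G.Adj (f (doilyLine k).1) (f (doilyLine k).2.2) ∧
      G.Adj (f (doilyLine k).2.1) (f (doilyLine k).2.2) := by
    intro k
    fin_cases k
    exacts [⟨hab, hac, hbc⟩, ⟨ha₁, ha₁', haa₁⟩, ⟨ha₂, ha₂', haa₂⟩, ⟨hb₁, hb₁', hbb₁⟩,
      ⟨hb₂, hb₂', hbb₂⟩, ⟨hc₁, hc₁', hcc₁⟩, ⟨hc₂, hc₂', hcc₂⟩, ⟨hab₁₁, hac₁₁, hbc₁₁⟩,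
      ⟨hab₁₂, hac₁₂, hbc₂₂⟩, ⟨l₁, l₃, l₅⟩, ⟨l₂, l₄, l₆⟩, ⟨hba₁₂.symm, m₂, l₈⟩, ⟨m₃, m₁, l₉⟩,
      ⟨l₇, m₂', l₈'⟩, ⟨m₃', m₁', l₉'⟩]
  refine ⟨f, fun q => ?_, fun i j hij => ?_⟩
  · rcases adj_of_triangle hcard hdeg hab hac hbc q with rfl | rfl | rfl | h | h | h
    · exact ⟨0, rfl⟩
    · exact ⟨1, rfl⟩
    · exact ⟨2, rfl⟩
    · rcases nbrA h with rfl | rfl | rfl | rfl | rfl | rfl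
      exacts [⟨1, rfl⟩, ⟨2, rfl⟩, ⟨3, rfl⟩, ⟨4, rfl⟩, ⟨5, rfl⟩, ⟨6, rfl⟩]
    · rcases nbrB h with rfl | rfl | rfl | rfl | rfl | rfl
      exacts [⟨0, rfl⟩, ⟨2, rfl⟩, ⟨7, rfl⟩, ⟨8, rfl⟩, ⟨9, rfl⟩, ⟨10, rfl⟩]
    · rcases nbrC h with rfl | rfl | rfl | rfl | rfl | rfl
      exacts [⟨0, rfl⟩, ⟨1, rfl⟩, ⟨11, rfl⟩, ⟨12, rfl⟩, ⟨13, rfl⟩, ⟨14, rfl⟩]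
  · obtain ⟨k, hi, hj⟩ := exists_doilyLine i j hij
    obtain ⟨h₁, h₂, h₃⟩ := hf k
    rcases hi with rfl | rfl | rfl <;> rcases hj with rfl | rfl | rfl
    exacts [(doily.irrefl hij).elim, h₁, h₂, h₁.symm, (doily.irrefl hij).elim, h₃, h₂.symm,
      h₃.symm, (doily.irrefl hij).elim]

/-- Uniqueness of the generalized quadrangle of order `(2, 2)`, in terms of its collinearity
graph. -/
theorem exists_doily_iso : ∃ f : Fin 15 → V, Function.Bijective f ∧
    ∀ i j, G.Adj (f i) (f j) ↔ doily.Adj i j := by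
  obtain ⟨f, hf, hom⟩ := exists_labelling hcard hdeg
  have hbij : Function.Bijective f :=
    (Fintype.bijective_iff_surjective_and_card f).2 ⟨hf, by simp [hcard]⟩
  refine ⟨f, hbij, fun i j => ⟨fun h => ?_, hom i j⟩⟩
  by_contra hij
  -- `j` is adjacent to a vertex `k` of a triangle `i k l`; if `f j` were adjacent to `f i`, it
  -- would be the third vertex `f l` of a triangle
  obtain ⟨k, l, hik, hil, hkl, hjk⟩ := exists_common_adj i j (fun e => h.ne (congrArg f e)) hij
  have := third_unique (hom _ _ hik) h (hom _ _ hjk).symm (hom _ _ hil) (hom _ _ hkl)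
  exact hij (hbij.1 this ▸ hil)

end Quadrangle

/-! ### The logic with 15 atoms -/

theorem finset_eq_duad_or : ∀ s : Finset (Fin 6), s.card ≡ 0 [MOD 2] →
    s = ∅ ∨ s = Finset.univ ∨ (∃ i, s = duad i) ∨ ∃ i, s = (duad i)ᶜ := by
  unfold Nat.ModEq
  decide +kernel

/-- The pairs, as elements of the logic of the even subsets of a six-element set. -/
def duadElement (i : Fin 15) : ModLogic 3 2 :=
  ⟨(duad i : Set (Fin 6)), by
    have h : ∀ i, (duad i).card = 2 := by decide
    change (duad i : Set (Fin 6)).ncard ≡ 0 [MOD 2]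
    rw [Set.ncard_coe_finset, h]
    rfl⟩

theorem exists_orderIso_modLogic :
    ∃ e : TriangleLogic doily ≃o ModLogic 3 2, ∀ x, e xᶜ = (e x)ᶜ := by
  refine exists_orderIso_triangleLogic duadElement ?_ ?_ ?_ ?_ ?_
  · have h : ∀ i j, duad i ⊆ duad j → i = j := by decide +kernel
    exact fun i j hij => h i j (Finset.coe_subset.1 hij)
  · have h : ∀ i, (duad i).Nonempty := by decide
    intro i hi
    exact Set.nonempty_iff_ne_empty.1 (Finset.coe_nonempty.2 (h i)) (congrArg Subtype.val hi)
  · intro i j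
    rw [show doily.Adj i j ↔ Disjoint (duad i) (duad j) from Iff.rfl, ← Finset.disjoint_coe]
    exact Set.subset_compl_iff_disjoint_right
  · rintro ⟨X, hX⟩
    obtain ⟨s, rfl⟩ : ∃ s : Finset (Fin 6), (s : Set (Fin 6)) = X :=
      ⟨_, (Set.toFinite (X : Set (Fin 6))).coe_toFinset⟩
    change (s : Set (Fin 6)).ncard ≡ 0 [MOD 2] at hX
    rw [Set.ncard_coe_finset] at hX
    rcases finset_eq_duad_or s hX with rfl | rfl | ⟨i, rfl⟩ | ⟨i, rfl⟩
    · exact .inl (Subtype.ext Finset.coe_empty)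
    · exact .inr (.inl (Subtype.ext Finset.coe_univ))
    · exact .inr (.inr (.inl ⟨i, rfl⟩))
    · exact .inr (.inr (.inr ⟨i, Subtype.ext (Finset.coe_compl _)⟩))
  · intro h
    have : (∅ : Set (Fin 6)) = Set.univ := congrArg Subtype.val h
    exact Set.empty_ne_univ this

theorem isomorphic_modLogic (L : Type u) [OrthomodularPoset L] [Finite L]
    (hL : IsHomogeneous 3 3 L) (h15 : {a : L | IsAtom a}.encard = 15) :
    Isomorphic L (ModLogic 3 2) := by
  classical
  have hB : ∀ B : Set L, IsBlock B → B.encard = 3 := fun B h => hL.2 B h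
  have := uniqueTriangles_orthGraph hB
  let _ : Fintype {a : L // IsAtom a} := Fintype.ofFinite _
  have hcard : Fintype.card {a : L // IsAtom a} = 15 := by
    have h : ((Fintype.card {a : L // IsAtom a} : ℕ) : ℕ∞) = 15 := by
      rw [← h15, ← Nat.card_eq_fintype_card]
      exact (Set.Finite.cast_ncard_eq (Set.toFinite {a : L | IsAtom a}))
    exact_mod_cast h
  have hdeg : ∀ a, ((orthGraph L).neighborFinset a).card = 6 := by
    intro a
    obtain ⟨s, hs, h⟩ := exists_finset_adj hB (hL.1 a.1 a.2)
    rw [← hs]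
    congr 1
    ext b
    rw [SimpleGraph.mem_neighborFinset, h]
  obtain ⟨f, hf, hadj⟩ := exists_doily_iso hcard hdeg
  have hne : (⊥ : L) ≠ ⊤ := fun h =>
    (f 0).2.1 (le_bot_iff.1 (h ▸ le_top))
  obtain ⟨e, he⟩ := exists_orderIso_triangleLogic (G := doily) (fun i => (f i).1)
    (fun i j h => hf.1 (Subtype.ext (((f j).2.le_iff.1 h).resolve_left (f i).2.1)))
    (fun i => (f i).2.1) (fun i j => hadj i j) (fun x => by
      have ex : ∀ y : L, IsAtom y → ∃ i, y = (f i).1 := fun y hy => by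
        obtain ⟨i, hi⟩ := hf.2 ⟨y, hy⟩
        exact ⟨i, by rw [hi]⟩
      rcases eq_bot_or_eq_top_or_isAtom hB x with h | h | h | h
      · exact .inl h
      · exact .inr (.inl h)
      · exact .inr (.inr (.inl (ex x h)))
      · obtain ⟨i, hi⟩ := ex _ h
        exact .inr (.inr (.inr ⟨i, by rw [← hi, compl_compl']⟩))) hne
  obtain ⟨e', he'⟩ := exists_orderIso_modLogic
  exact isomorphic_of_orderIso e he e' he'

theorem theorem2p1 :
    -- part 1
    (∀ (L : Type u) [OrthomodularPoset L] [Finite L],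
      OrthomodularPoset.IsHomogeneous 3 3 L → {a : L | IsAtom a}.encard = 15 →
        OrthomodularPoset.Isomorphic L (ModLogic 3 2)) ∧
    -- part 2, the logic with 17 atoms
    (∃ (L : Type) (_ : OrthomodularPoset L) (f : Diagram17.Vertex → L),
      Finite L ∧ OrthomodularPoset.IsGreechieDiagram Diagram17.edges f ∧
      OrthomodularPoset.IsHomogeneous 3 3 L ∧ {a : L | IsAtom a}.encard = 17 ∧
      OrthomodularPoset.twoValuedStates L = ∅ ∧
      ∃ e : ConvexIso (OrthomodularPoset.stateSpace L) (Set.Icc (0 : ℝ) (2 / 3)),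
        ∀ s : OrthomodularPoset.stateSpace L, (e.toEquiv s : ℝ) = s.1 (f (Diagram17.P 0))) ∧
    -- part 2, the logic with 27 atoms
    (∃ (L : Type) (_ : OrthomodularPoset L) (f : Diagram27.Vertex → L),
      Finite L ∧ OrthomodularPoset.IsGreechieDiagram Diagram27.edges f ∧
      OrthomodularPoset.IsHomogeneous 3 3 L ∧ {a : L | IsAtom a}.encard = 27 ∧
      OrthomodularPoset.IsFull (OrthomodularPoset.twoValuedStates L) ∧
      (OrthomodularPoset.twoValuedStates L).encard = 12 ∧
      IsConcreteLogic (OrthomodularPoset.totalRepresentation L) ∧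
      IsRegularLogic (OrthomodularPoset.totalRepresentation L)) := by
  exact ⟨fun L _ _ hL h15 => isomorphic_modLogic L hL h15, Diagram17.exists_logic,
    Diagram27.exists_logic⟩
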